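/- Let $a>0$. The equation $\frac{x}{\frac94(2+a)\ln x}=3$ has exactly one solution $x_0\ge 3$, and there is a constant $C>0$ depending only on $a$ such that the following holds for every real $f>6$ and every integer $n\ge\lceil x_0\rceil$. Let $X_1,\dots,X_n$ be independent random variables, uniform on $[0,1]$: the initial positions of $n$ sensors of range $r=\frac{f}{2n}$. Final positions $y_1,\dots,y_n$ of the sensors cover $[0,1]$ if every $t\in[0,1]$ satisfies $|t-y_i|\le r$ for some $i$, and the total movement to the power $a$ from $x$ to $y$ is $\sum_{i=1}^n|x_i-y_i|^a$. Then the expected total movement to the power $a$ required to cover $[0,1]$ satisfies $$\mathbb E\Big[\inf\Big\{\sum_{i=1}^n|X_i-y_i|^a : y\in\mathbb R^n \text{ covers } [0,1]\Big\}\Big]\le C\,\frac{1}{n^{\frac a2-1}}\Big(\frac{\ln n}{n}\Big)^{\frac a2}.$$ Moreover, this bound is achieved by the following algorithm: its final placement always lies in $[0,1]$ and covers $[0,1]$, and its expected total movement to the power $a$ (over the initial positions and the random choices) is at most $C\,\frac{1}{n^{a/2-1}}\big(\frac{\ln n}{n}\big)^{a/2}$. Put $p=\frac94(2+a)$, $q=\frac34(2+a)$,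 $k=\lfloor\frac{n}{p\ln n}\rfloor$, $m=\lfloor q\ln n\rfloor$, and divide $[0,1]$ into $k$ subintervals of length $\frac1k$. If some subinterval contains fewer than $\frac13\cdot\frac nk$ sensors, move, for $i=1,\dots,n$, the $i$-th sensor from the left to $\frac in-\frac1{2n}$. Otherwise choose, in each subinterval independently and uniformly at random, $m$ of the sensors in it, and move, for $i=1,\dots,m$, the $i$-th chosen sensor from the left in the $j$-th subinterval ($j=1,\dots,k$) to $\frac{j-1}{k}+\frac1k\big(\frac im-\frac1{2m}\big)$; the other sensors do not move. -/

import Mathlib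

open MeasureTheory ProbabilityTheory
open scoped ENNReal

noncomputable section

namespace SensorCover

/-- Sensors of range `r` located at `y` cover the unit interval. -/
def Covers {n : ℕ} (r : ℝ) (y : Fin n → ℝ) : Prop :=
  ∀ t ∈ Set.Icc (0 : ℝ) 1, ∃ i, |t - y i| ≤ r

/-- Total movement to the power `a` when the `i`-th sensor goes from `x i` to `y i`. -/
def movement {n : ℕ} (a : ℝ) (x y : Fin n → ℝ) : ℝ≥0∞ :=
  ∑ i, ENNReal.ofReal (|x i - y i| ^ a)

/-- The total movement to the power `a` required to cover the unit interval with sensors of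
range `r` that are initially at `x`: the infimum over all covering final placements on the line
(it is `∞` if there is none). -/
def minMovement {n : ℕ} (a r : ℝ) (x : Fin n → ℝ) : ℝ≥0∞ :=
  ⨅ (y : Fin n → ℝ) (_ : Covers r y), movement a x y

/-- `x₀` solves `x / ((9/4) (2 + a) ln x) = 3` and `x₀ ≥ 3`. -/
def IsThreshold (a x₀ : ℝ) : Prop :=
  3 ≤ x₀ ∧ x₀ / (9 / 4 * (2 + a) * Real.log x₀) = 3

/-- The number `⌊n / (p ln n)⌋` of subintervals, where `p = (9/4) (2 + a)`. -/
def numCells (a : ℝ) (n : ℕ) : ℕ := ⌊(n : ℝ) / (9 / 4 * (2 + a) * Real.log n)⌋₊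

/-- The number `⌊q ln n⌋` of sensors chosen in each subinterval, where `q = (3/4) (2 + a)`. -/
def numChosen (a : ℝ) (n : ℕ) : ℕ := ⌊3 / 4 * (2 + a) * Real.log n⌋₊

/-- The index `j < k` of the subinterval of length `1 / k` that contains the point `t` of `[0,1]`:
the subintervals are `[j/k, (j+1)/k)`, the last one being closed. -/
def cellIndex (k : ℕ) (t : ℝ) : ℕ := min ⌊(k : ℝ) * t⌋₊ (k - 1)

/-- The sensors of the set `T` that lie in the `j`-th of `k` subintervals. -/
def inCell {n : ℕ} (k : ℕ) (x : Fin n → ℝ) (T : Finset (Fin n)) (j : ℕ) : Finset (Fin n) :=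
  T.filter fun i => cellIndex k (x i) = j

/-- The number of sensors of `T` to the left of the sensor `i` (ties broken by the labels). -/
def rank {n : ℕ} (x : Fin n → ℝ) (T : Finset (Fin n)) (i : Fin n) : ℕ :=
  (T.filter fun l => x l < x i ∨ (x l = x i ∧ l < i)).card

/-- All `n` sensors move to the equidistant positions `i/n - 1/(2n)`, `i = 1, …, n`, the `i`-th
sensor from the left to the `i`-th position. -/
def equidistant {n : ℕ} (x : Fin n → ℝ) (i : Fin n) : ℝ :=
  ((rank x Finset.univ i : ℝ) + 1 / 2) / n

/-- In each of `k` subintervals the sensors of `T` in it (`m` of them) move, in their order, to the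
equidistant positions at distance `1 / (k m)` in that subinterval; the other sensors stay. -/
def moveChosen {n : ℕ} (k m : ℕ) (x : Fin n → ℝ) (T : Finset (Fin n)) (i : Fin n) : ℝ :=
  if i ∈ T then
    (cellIndex k (x i) : ℝ) / k
      + ((rank x (inCell k x T (cellIndex k (x i))) i : ℝ) + 1 / 2) / (k * m)
  else x i

/-- Some subinterval holds fewer than `(1/3) n / ⌊n / (p ln n)⌋` sensors. -/
def HasSparseCell {n : ℕ} (a : ℝ) (x : Fin n → ℝ) : Prop :=
  ∃ j < numCells a n,
    ((inCell (numCells a n) x Finset.univ j).card : ℝ) < 1 / 3 * ((n : ℝ) / numCells a n)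

/-- The sets of sensors with exactly `⌊q ln n⌋` elements in each subinterval. A uniformly random
one amounts to independent uniformly random choices in the subintervals. -/
def choices {n : ℕ} (a : ℝ) (x : Fin n → ℝ) : Finset (Finset (Fin n)) :=
  Finset.univ.filter fun T =>
    ∀ j < numCells a n, (inCell (numCells a n) x T j).card = numChosen a n

theorem choices_nonempty {n : ℕ} (a : ℝ) (x : Fin n → ℝ) (h : ¬ HasSparseCell a x) :
    (choices a x).Nonempty := by
  have key : ∀ j < numCells a n,
      numChosen a n ≤ (inCell (numCells a n) x Finset.univ j).card := by
    intro j hj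
    have hc : 1 / 3 * ((n : ℝ) / numCells a n)
        ≤ ((inCell (numCells a n) x Finset.univ j).card : ℝ) := by
      by_contra hlt
      exact h ⟨j, hj, not_le.mp hlt⟩
    have hk : 0 < numCells a n := by omega
    have hk' : (0 : ℝ) < numCells a n := by exact_mod_cast hk
    have h1 : (1 : ℝ) ≤ (n : ℝ) / (9 / 4 * (2 + a) * Real.log n) := by
      by_contra hlt
      have : numCells a n = 0 := Nat.floor_eq_zero.mpr (not_le.mp hlt)
      omega
    have hD : 0 < 9 / 4 * (2 + a) * Real.log n := by
      by_contra hle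
      have := div_nonpos_of_nonneg_of_nonpos (Nat.cast_nonneg (α := ℝ) n) (not_lt.mp hle)
      linarith
    have h2 : (numCells a n : ℝ) ≤ (n : ℝ) / (9 / 4 * (2 + a) * Real.log n) :=
      Nat.floor_le (by linarith)
    have h3 : 9 / 4 * (2 + a) * Real.log n ≤ (n : ℝ) / numCells a n := by
      rw [le_div_iff₀ hD] at h2
      rw [le_div_iff₀ hk']
      linarith
    have h4 : (numChosen a n : ℝ) ≤ 3 / 4 * (2 + a) * Real.log n :=
      Nat.floor_le (by linarith)
    have h5 : (numChosen a n : ℝ) ≤ ((inCell (numCells a n) x Finset.univ j).card : ℝ) := by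
      linarith
    exact_mod_cast h5
  have ex : ∀ j, ∃ U : Finset (Fin n), j < numCells a n →
      U ⊆ inCell (numCells a n) x Finset.univ j ∧ U.card = numChosen a n := by
    intro j
    by_cases hj : j < numCells a n
    · obtain ⟨U, hU⟩ := Finset.exists_subset_card_eq (key j hj)
      exact ⟨U, fun _ => hU⟩
    · exact ⟨∅, fun h => absurd h hj⟩
  choose U hU using ex
  refine ⟨(Finset.range (numCells a n)).biUnion U, ?_⟩
  simp only [choices, Finset.mem_filter, Finset.mem_univ, true_and]
  intro j hj
  rw [← (hU j hj).2]
  congr 1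
  ext i
  simp only [inCell, Finset.mem_filter, Finset.mem_biUnion, Finset.mem_range]
  constructor
  · rintro ⟨⟨l, hl, hil⟩, hij⟩
    have := (hU l hl).1 hil
    simp only [inCell, Finset.mem_filter] at this
    have hlj : l = j := this.2.symm.trans hij
    exact hlj ▸ hil
  · intro hi
    have := (hU j hj).1 hi
    simp only [inCell, Finset.mem_filter] at this
    exact ⟨⟨j, hj, hi⟩, this.2⟩

open Classical in
/-- The randomized displacement algorithm: the law of the final placement of sensors that are
initially at `x`. -/
def algorithm {n : ℕ} (a : ℝ) (x : Fin n → ℝ) : PMF (Fin n → ℝ) :=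
  if h : HasSparseCell a x then PMF.pure (equidistant x)
  else (PMF.uniformOfFinset (choices a x) (choices_nonempty a x h)).map
    (moveChosen (numCells a n) (numChosen a n) x)

/-- The expected total movement to the power `a` of the algorithm started at `x`, over its internal
random choices. -/
def algorithmMovement {n : ℕ} (a : ℝ) (x : Fin n → ℝ) : ℝ≥0∞ :=
  ∑' y : Fin n → ℝ, algorithm a x y * movement a x y

/-- The rate `n ^ (1 - a/2) * (ln n / n) ^ (a/2)`. -/
def rate (a : ℝ) (n : ℕ) : ℝ :=
  1 / (n : ℝ) ^ (a / 2 - 1) * (Real.log n / n) ^ (a / 2)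

end SensorCover

end

noncomputable section

namespace SensorCover

/-! The algorithm always ends in a covering placement, so its expected cost bounds the expected
minimum, and only that cost has to be estimated.

Covering: placing `m` sensors at the centres of `m` equal pieces of each of `k` cells leaves every
point within `1/(2km)` of a sensor. Rounding costs little enough that `n ≤ 6km`
(`IsLarge.le_cells_mul_chosen`), and `f > 6` gives `1/(2km) ≤ r`. The equidistant placement is the
case of one cell and `m = n`, so both branches share the same lemmas.

Dense case: condition on the cell of every sensor. The sensors stay independent, each uniform on its
cell, and the admissible choices `T` are fixed. For a chosen sensor at relative position `u` in its
cell, `km` times its displacement is `rank + 1/2 - m u`, where the rank is a sum of `m - 1`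
independent Bernoulli(`u`) variables. Its exponential moment at `λ`, for `|λ| ≤ 1`, is at most
`exp(m λ² + 1)` (`lintegral_exp_rank_le`). Taking `λ = ±1/√m` makes the `a`-th moment of the
displacement `O((√m/(km))^a) = O((√(ln n)/n)^a)`, and summing over `n` sensors gives the rate.

Sparse case: a Chernoff and union bound gives probability at most `n^(-a/2)` (`unitLaw_sparse_le`).
Displacements are then at most `(1+a)√(ln n / n)` up to an error of expectation `O(n^(-a))`
(`setLIntegral_equidistant_rpow_le`). The product is again of the order of the rate. -/

/-! ### The threshold equation and the sizes of `k` and `m`. -/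

theorem one_lt_log_of_three_le {x : ℝ} (hx : 3 ≤ x) : 1 < Real.log x := by
  rw [Real.lt_log_iff_exp_lt (by linarith)]
  linarith [Real.exp_one_lt_three]

theorem isThreshold_iff {a x : ℝ} (ha : 0 < a) :
    IsThreshold a x ↔ 3 ≤ x ∧ x = 27 / 4 * (2 + a) * Real.log x := by
  refine and_congr_right fun hx => ?_
  have hl := one_lt_log_of_three_le hx
  have : 0 < 9 / 4 * (2 + a) * Real.log x := by positivity
  rw [div_eq_iff this.ne']
  constructor <;> intro h <;> linarith

/-- With `c = 27/4 (2 + a)`, the slope of `c log` at `x` is `c/x < 1`, because `x = c log x` and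
`log x > 1`; by concavity the curve stays below the diagonal afterwards. This gives uniqueness of
the threshold and the size condition beyond it. -/
theorem log_growth_of_threshold {a x y : ℝ} (ha : 0 < a) (h : IsThreshold a x) (hxy : x < y) :
    27 / 4 * (2 + a) * Real.log y < y := by
  obtain ⟨h3, hx⟩ := (isThreshold_iff ha).1 h
  have hl := one_lt_log_of_three_le h3
  have hx0 : 0 < x := by linarith
  have hlog : Real.log y - Real.log x < y / x - 1 := by
    rw [← Real.log_div (by linarith) hx0.ne']
    exact Real.log_lt_sub_one_of_pos (div_pos (by linarith) hx0)
      ((one_lt_div hx0).2 hxy).ne'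
  set c := 27 / 4 * (2 + a) with hc
  have hc0 : 0 < c := by positivity
  have hcx : c < x := by nlinarith
  have h1 : c * (Real.log y - Real.log x) < c * (y / x - 1) := mul_lt_mul_of_pos_left hlog hc0
  have h2 : c * (y / x - 1) ≤ x * (y / x - 1) := by
    apply mul_le_mul_of_nonneg_right hcx.le
    have := (one_lt_div hx0).2 hxy
    linarith
  have h3 : x * (y / x - 1) = y - x := by field_simp
  nlinarith

theorem existsUnique_isThreshold {a : ℝ} (ha : 0 < a) : ∃! x : ℝ, IsThreshold a x := by
  obtain ⟨x, hx⟩ : ∃ x, IsThreshold a x := by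
    set c := 27 / 4 * (2 + a) with hc
    have hc0 : 27 / 2 < c := by rw [hc]; linarith
    -- The right endpoint is a square so that `log ((2c)²) = 2 log (2c) ≤ 2(2c - 1)` already forces
    -- the right sign.
    have hM : (3 : ℝ) ≤ (2 * c) ^ 2 := by nlinarith
    have hcont : ContinuousOn (fun x : ℝ => x - c * Real.log x) (Set.Icc 3 ((2 * c) ^ 2)) := by
      refine continuousOn_id.sub (continuousOn_const.mul (Real.continuousOn_log.mono ?_))
      intro x hx
      have := hx.1
      simp only [Set.mem_compl_iff, Set.mem_singleton_iff]
      linarith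
    have h0 : (0 : ℝ) ∈ Set.Icc (3 - c * Real.log 3) ((2 * c) ^ 2 - c * Real.log ((2 * c) ^ 2)) := by
      constructor
      · nlinarith [one_lt_log_of_three_le le_rfl]
      · rw [Real.log_pow]
        have := Real.log_le_sub_one_of_pos (show 0 < 2 * c by linarith)
        push_cast
        nlinarith
    obtain ⟨x, hx, hx0⟩ := intermediate_value_Icc hM hcont h0
    exact ⟨x, (isThreshold_iff ha).2 ⟨hx.1, sub_eq_zero.1 hx0⟩⟩
  refine ⟨x, hx, fun y hy => ?_⟩
  rcases lt_trichotomy x y with h | h | h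
  · have := log_growth_of_threshold ha hx h
    have := ((isThreshold_iff ha).1 hy).2
    linarith
  · exact h.symm
  · have := log_growth_of_threshold ha hy h
    have := ((isThreshold_iff ha).1 hx).2
    linarith

/-- `n` is large enough for the cells of the algorithm to be well defined. -/
structure IsLarge (a : ℝ) (n : ℕ) : Prop where
  two_le_log : 2 ≤ Real.log n
  log_le : 27 / 4 * (2 + a) * Real.log n ≤ n

theorem isLarge_of_threshold {a x : ℝ} {n : ℕ} (ha : 0 < a) (h : IsThreshold a x)
    (hn : ⌈x⌉₊ ≤ n) : IsLarge a n := by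
  have hxn : x ≤ n := Nat.ceil_le.1 hn
  obtain ⟨h3, hx⟩ := (isThreshold_iff ha).1 h
  have hl := one_lt_log_of_three_le h3
  refine ⟨?_, ?_⟩
  -- The equation and `log x > 1` give `x > 27/2 > 9 > e²`.
  · rw [Real.le_log_iff_exp_le (by linarith), show (2 : ℝ) = 1 + 1 by norm_num, Real.exp_add]
    have := Real.exp_one_lt_three
    have := Real.exp_pos 1
    nlinarith
  · rcases hxn.eq_or_lt with h' | h'
    · rw [← h']; exact hx.ge
    · exact (log_growth_of_threshold ha h h').le

namespace IsLarge

variable {a : ℝ} {n : ℕ}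

theorem pos (h : IsLarge a n) : 0 < n := by
  rcases Nat.eq_zero_or_pos n with rfl | h'
  · have := h.two_le_log
    norm_num at this
  · exact h'

theorem three_le_div (ha : 0 < a) (h : IsLarge a n) :
    3 ≤ (n : ℝ) / (9 / 4 * (2 + a) * Real.log n) := by
  have := h.two_le_log
  rw [le_div_iff₀ (by positivity)]
  linarith [h.log_le]

theorem numCells_pos (ha : 0 < a) (h : IsLarge a n) : 0 < numCells a n :=
  Nat.floor_pos.2 (by linarith [h.three_le_div ha])

theorem numCells_mul_le (ha : 0 < a) (h : IsLarge a n) :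
    (numCells a n : ℝ) * (9 / 4 * (2 + a) * Real.log n) ≤ n := by
  have := h.two_le_log
  rw [← le_div_iff₀ (by positivity)]
  exact Nat.floor_le (by linarith [h.three_le_div ha])

theorem numCells_le (ha : 0 < a) (h : IsLarge a n) : (numCells a n : ℝ) ≤ n := by
  have h1 := h.numCells_mul_le ha
  have h2 := h.two_le_log
  have h3 : (numCells a n : ℝ) * 1 ≤ (numCells a n : ℝ) * (9 / 4 * (2 + a) * Real.log n) :=
    mul_le_mul_of_nonneg_left (by nlinarith) (by positivity)
  linarith

theorem numChosen_le (ha : 0 < a) (h : IsLarge a n) :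
    (numChosen a n : ℝ) ≤ 3 / 4 * (2 + a) * Real.log n :=
  Nat.floor_le (by have := h.two_le_log; positivity)

theorem numChosen_pos (ha : 0 < a) (h : IsLarge a n) : 0 < numChosen a n :=
  Nat.floor_pos.2 (by nlinarith [h.two_le_log])

/-- The source of the constant in `f > 6`. With `D = (2 + a) log n`, rounding `k ≥ 3` down loses a
factor at most `4/3`, so `n ≤ 3Dk`; as `D ≥ 4`, rounding `m` down still leaves `D ≤ 2m`. -/
theorem le_cells_mul_chosen (ha : 0 < a) (h : IsLarge a n) :
    (n : ℝ) ≤ 6 * (numCells a n * numChosen a n) := by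
  have hL := h.two_le_log
  set D := (2 + a) * Real.log n with hD
  have hD0 : 4 ≤ D := by rw [hD]; nlinarith
  have hk : (3 : ℝ) ≤ numCells a n := by
    have : 3 ≤ numCells a n := Nat.le_floor (by exact_mod_cast h.three_le_div ha)
    exact_mod_cast this
  have hk' : (n : ℝ) / (9 / 4 * D) < numCells a n + 1 := by
    have := Nat.lt_floor_add_one ((n : ℝ) / (9 / 4 * (2 + a) * Real.log n))
    rw [mul_assoc (9 / 4 : ℝ), ← hD] at this
    rwa [numCells, mul_assoc (9 / 4 : ℝ), ← hD]
  rw [div_lt_iff₀ (by positivity)] at hk'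
  have hm : 3 / 4 * D < numChosen a n + 1 := by
    have := Nat.lt_floor_add_one (3 / 4 * (2 + a) * Real.log n)
    rw [mul_assoc (3 / 4 : ℝ), ← hD] at this
    rwa [numChosen, mul_assoc (3 / 4 : ℝ), ← hD]
  have h1 : (n : ℝ) ≤ 3 * D * numCells a n := by nlinarith
  have h2 : D ≤ 2 * numChosen a n := by linarith
  nlinarith

end IsLarge

/-! ### Ranks within a set of sensors. -/

section Rank

variable {n : ℕ}

theorem rank_lt_card (x : Fin n → ℝ) {S : Finset (Fin n)} {i : Fin n} (hi : i ∈ S) :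
    rank x S i < S.card := by
  refine Finset.card_lt_card (Finset.filter_ssubset.2 ⟨i, hi, ?_⟩)
  simp

theorem rank_lt_rank {x : Fin n → ℝ} {S : Finset (Fin n)} {i l : Fin n} (hl : l ∈ S)
    (h : x l < x i ∨ (x l = x i ∧ l < i)) : rank x S l < rank x S i := by
  refine Finset.card_lt_card ?_
  rw [Finset.ssubset_iff_of_subset]
  · refine ⟨l, Finset.mem_filter.2 ⟨hl, h⟩, ?_⟩
    simp
  · intro b hb
    rw [Finset.mem_filter] at hb ⊢
    refine ⟨hb.1, ?_⟩
    rcases hb.2 with h1 | ⟨h1, h1'⟩ <;> rcases h with h2 | ⟨h2, h2'⟩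
    · exact Or.inl (h1.trans h2)
    · exact Or.inl (h2 ▸ h1)
    · exact Or.inl (h1 ▸ h2)
    · exact Or.inr ⟨h1.trans h2, h1'.trans h2'⟩

theorem rank_injOn (x : Fin n → ℝ) (S : Finset (Fin n)) : Set.InjOn (rank x S) S := by
  intro i hi l hl h
  by_contra hne
  rcases lt_trichotomy (x i) (x l) with h' | h' | h'
  · exact (rank_lt_rank hi (Or.inl h')).ne h
  · rcases lt_or_gt_of_ne hne with h'' | h''
    · exact (rank_lt_rank hi (Or.inr ⟨h', h''⟩)).ne h
    · exact (rank_lt_rank hl (Or.inr ⟨h'.symm, h''⟩)).ne h.symm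
  · exact (rank_lt_rank hl (Or.inl h')).ne h.symm

/-- Breaking ties by label makes the rank injective with values below `S.card`, hence onto: every
target position receives a sensor even if initial positions coincide. -/
theorem exists_rank_eq (x : Fin n → ℝ) {S : Finset (Fin n)} {r : ℕ} (hr : r < S.card) :
    ∃ i ∈ S, rank x S i = r := by
  have : S.image (rank x S) = Finset.range S.card := by
    refine Finset.eq_of_subset_of_card_le ?_ ?_
    · intro r hr
      obtain ⟨i, hi, rfl⟩ := Finset.mem_image.1 hr
      exact Finset.mem_range.2 (rank_lt_card x hi)
    · rw [Finset.card_range, Finset.card_image_of_injOn (rank_injOn x S)]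
  have hmem := Finset.mem_range.2 hr
  rw [← this] at hmem
  exact Finset.mem_image.1 hmem

end Rank

/-! ### Cells and the final placement inside them. -/

theorem cellIndex_lt {k : ℕ} (hk : 0 < k) (t : ℝ) : cellIndex k t < k :=
  (min_le_right _ _).trans_lt (by omega)

theorem cellIndex_le {k : ℕ} {t : ℝ} (ht : 0 ≤ t) : (cellIndex k t : ℝ) ≤ k * t := by
  have h1 : (cellIndex k t : ℝ) ≤ ⌊(k : ℝ) * t⌋₊ := by exact_mod_cast min_le_left _ _
  exact h1.trans (Nat.floor_le (by positivity))

theorem le_cellIndex_add_one {k : ℕ} {t : ℝ} (ht : t ≤ 1) : (k : ℝ) * t ≤ cellIndex k t + 1 := by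
  rcases Nat.eq_zero_or_pos k with rfl | hk
  · have : (0 : ℝ) ≤ cellIndex 0 t := by positivity
    push_cast
    linarith
  rcases le_total ⌊(k : ℝ) * t⌋₊ (k - 1) with h | h
  · rw [cellIndex, min_eq_left h]
    exact (Nat.lt_floor_add_one _).le
  · rw [cellIndex, min_eq_right h, Nat.cast_sub hk]
    have : (k : ℝ) * t ≤ k * 1 := by gcongr
    push_cast
    linarith

theorem mem_inCell {n k : ℕ} {x : Fin n → ℝ} {T : Finset (Fin n)} {j : ℕ} {i : Fin n} :
    i ∈ inCell k x T j ↔ i ∈ T ∧ cellIndex k (x i) = j := Finset.mem_filter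

section MoveChosen

variable {n k m : ℕ} {x : Fin n → ℝ} {T : Finset (Fin n)}

theorem moveChosen_of_mem {i : Fin n} (hi : i ∈ T) :
    moveChosen k m x T i = (cellIndex k (x i) : ℝ) / k
      + ((rank x (inCell k x T (cellIndex k (x i))) i : ℝ) + 1 / 2) / (k * m) := if_pos hi

theorem moveChosen_of_notMem {i : Fin n} (hi : i ∉ T) : moveChosen k m x T i = x i := if_neg hi

theorem moveChosen_mem_unit (hk : 0 < k) (hm : 0 < m)
    (hT : ∀ j < k, (inCell k x T j).card = m) (hx : ∀ i, x i ∈ Set.Icc (0 : ℝ) 1) (i : Fin n) :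
    moveChosen k m x T i ∈ Set.Icc (0 : ℝ) 1 := by
  by_cases hi : i ∈ T
  swap
  · rw [moveChosen_of_notMem hi]; exact hx i
  rw [moveChosen_of_mem hi]
  refine ⟨by positivity, ?_⟩
  have hj := cellIndex_lt hk (x i)
  have hr : rank x (inCell k x T (cellIndex k (x i))) i < m := by
    rw [← hT _ hj]
    exact rank_lt_card x (mem_inCell.2 ⟨hi, rfl⟩)
  have hj' : (cellIndex k (x i) : ℝ) + 1 ≤ k := by exact_mod_cast hj
  have hr' : (rank x (inCell k x T (cellIndex k (x i))) i : ℝ) + 1 ≤ m := by exact_mod_cast hr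
  have hk' : (0 : ℝ) < k := by exact_mod_cast hk
  have hm' : (0 : ℝ) < m := by exact_mod_cast hm
  have h1 : ((rank x (inCell k x T (cellIndex k (x i))) i : ℝ) + 1 / 2) / (k * m) ≤ 1 / k := by
    rw [div_le_div_iff₀ (by positivity) hk']
    nlinarith
  calc _ ≤ (cellIndex k (x i) : ℝ) / k + 1 / k := by gcongr
    _ = (cellIndex k (x i) + 1) / k := by ring
    _ ≤ 1 := (div_le_one hk').2 hj'

theorem moveChosen_covers {r : ℝ} (hk : 0 < k) (hm : 0 < m)
    (hT : ∀ j < k, (inCell k x T j).card = m) (hr : 1 / (2 * (k * m)) ≤ r) :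
    Covers r (moveChosen k m x T) := by
  intro t ht
  have hk' : (0 : ℝ) < k := by exact_mod_cast hk
  have hm' : (0 : ℝ) < m := by exact_mod_cast hm
  set j := cellIndex k t with hj
  have hjk : j < k := cellIndex_lt hk t
  have h1 : 0 ≤ (k : ℝ) * t - j := sub_nonneg.2 (cellIndex_le ht.1)
  have h2 : (k : ℝ) * t - j ≤ 1 := by linarith [le_cellIndex_add_one (k := k) ht.2]
  -- The same subdivision applied inside the rescaled cell: `t` lies in its `s`-th piece, whose
  -- centre is the target of the sensor of rank `s`.
  set s := cellIndex m ((k : ℝ) * t - j) with hs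
  have hsm : s < m := cellIndex_lt hm _
  have h3 : (s : ℝ) ≤ m * (k * t - j) := cellIndex_le h1
  have h4 : m * (k * t - j) ≤ (s : ℝ) + 1 := le_cellIndex_add_one h2
  rw [← hT j hjk] at hsm
  obtain ⟨i, hi, his⟩ := exists_rank_eq x hsm
  obtain ⟨hiT, hij⟩ := mem_inCell.1 hi
  refine ⟨i, le_trans ?_ hr⟩
  rw [moveChosen_of_mem hiT, hij, his]
  have : t - ((j : ℝ) / k + (s + 1 / 2) / (k * m))
      = (m * (k * t - j) - s - 1 / 2) / (k * m) := by
    field_simp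
    ring
  rw [this, abs_div, abs_of_pos (mul_pos hk' hm'), ← div_div 1,
    div_le_div_iff_of_pos_right (by positivity), abs_le]
  constructor <;> linarith

theorem cellIndex_one (t : ℝ) : cellIndex 1 t = 0 := by simp [cellIndex]

theorem inCell_one_univ (x : Fin n → ℝ) : inCell 1 x Finset.univ 0 = Finset.univ := by
  ext i
  simp [mem_inCell, cellIndex_one]

theorem equidistant_eq_moveChosen (x : Fin n → ℝ) :
    equidistant x = moveChosen 1 n x Finset.univ := by
  ext i
  rw [moveChosen_of_mem (Finset.mem_univ i), cellIndex_one, inCell_one_univ, equidistant]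
  simp

end MoveChosen

/-! ### Validity and cost of the algorithm. -/

theorem mem_choices {n : ℕ} {a : ℝ} {x : Fin n → ℝ} {T : Finset (Fin n)} :
    T ∈ choices a x ↔ ∀ j < numCells a n, (inCell (numCells a n) x T j).card = numChosen a n := by
  simp [choices]

theorem exists_of_mem_support {n : ℕ} {a : ℝ} (ha : 0 < a) (hn : IsLarge a n) {x y : Fin n → ℝ}
    (hy : y ∈ (algorithm a x).support) :
    ∃ (k m : ℕ) (T : Finset (Fin n)), 0 < k ∧ 0 < m ∧ (n : ℝ) ≤ 6 * (k * m) ∧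
      (∀ j < k, (inCell k x T j).card = m) ∧ y = moveChosen k m x T := by
  unfold algorithm at hy
  split_ifs at hy with h
  · refine ⟨1, n, Finset.univ, one_pos, hn.pos, ?_, ?_, ?_⟩
    · have : (0 : ℝ) ≤ n := by positivity
      push_cast
      linarith
    · intro j hj
      obtain rfl : j = 0 := by omega
      rw [inCell_one_univ]
      simp
    · rw [← equidistant_eq_moveChosen]
      simpa using hy
  · rw [PMF.mem_support_map_iff] at hy
    obtain ⟨T, hT, rfl⟩ := hy
    rw [PMF.mem_support_uniformOfFinset_iff] at hT
    exact ⟨_, _, T, hn.numCells_pos ha, hn.numChosen_pos ha, hn.le_cells_mul_chosen ha,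
      mem_choices.1 hT, rfl⟩

theorem algorithm_valid {n : ℕ} {a f : ℝ} (ha : 0 < a) (hf : 6 < f) (hn : IsLarge a n)
    {x y : Fin n → ℝ} (hx : ∀ i, x i ∈ Set.Icc (0 : ℝ) 1) (hy : y ∈ (algorithm a x).support) :
    Covers (f / (2 * n)) y ∧ ∀ i, y i ∈ Set.Icc (0 : ℝ) 1 := by
  obtain ⟨k, m, T, hk, hm, hkm, hT, rfl⟩ := exists_of_mem_support ha hn hy
  refine ⟨moveChosen_covers hk hm hT ?_, moveChosen_mem_unit hk hm hT hx⟩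
  have hn' : (0 : ℝ) < n := by exact_mod_cast hn.pos
  have hk' : (0 : ℝ) < k := by exact_mod_cast hk
  have hm' : (0 : ℝ) < m := by exact_mod_cast hm
  rw [div_le_div_iff₀ (by positivity) (by positivity)]
  nlinarith [mul_pos hk' hm']

theorem algorithmMovement_of_sparse {n : ℕ} {a : ℝ} {x : Fin n → ℝ} (h : HasSparseCell a x) :
    algorithmMovement a x = movement a x (moveChosen 1 n x Finset.univ) := by
  rw [algorithmMovement, tsum_eq_single (equidistant x)]
  · simp [algorithm, h, equidistant_eq_moveChosen]
  · intro y hy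
    simp [algorithm, h, hy]

theorem algorithmMovement_of_not_sparse {n : ℕ} {a : ℝ} {x : Fin n → ℝ}
    (h : ¬ HasSparseCell a x) :
    algorithmMovement a x = ∑ T ∈ choices a x, ((choices a x).card : ℝ≥0∞)⁻¹
      * movement a x (moveChosen (numCells a n) (numChosen a n) x T) := by
  simp only [algorithmMovement, algorithm, h, dif_neg, not_false_eq_true, PMF.map_apply,
    ← ENNReal.tsum_mul_right]
  rw [ENNReal.tsum_comm, tsum_eq_sum (s := choices a x)]
  · refine Finset.sum_congr rfl fun T hT => ?_
    rw [tsum_eq_single (moveChosen (numCells a n) (numChosen a n) x T)]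
    · simp [hT]
    · intro y hy
      simp [hy]
  · intro T hT
    simp [hT]

/-- The algorithm's cost is an average over placements in its support, each of which is a candidate
in the infimum. -/
theorem minMovement_le_algorithmMovement {n : ℕ} {a f : ℝ} (ha : 0 < a) (hf : 6 < f)
    (hn : IsLarge a n) {x : Fin n → ℝ} (hx : ∀ i, x i ∈ Set.Icc (0 : ℝ) 1) :
    minMovement a (f / (2 * n)) x ≤ algorithmMovement a x := by
  calc minMovement a (f / (2 * n)) x
      = ∑' y, algorithm a x y * minMovement a (f / (2 * n)) x := by
        rw [ENNReal.tsum_mul_right, PMF.tsum_coe, one_mul]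
    _ ≤ algorithmMovement a x := by
        refine ENNReal.tsum_le_tsum fun y => ?_
        by_cases hy : y ∈ (algorithm a x).support
        · gcongr
          exact iInf₂_le y (algorithm_valid ha hf hn hx hy).1
        · rw [PMF.mem_support_iff, not_not] at hy
          simp [hy]

/-! ### Product integrals and the law conditioned on cells. -/

/-- Tonelli with coordinate `i` outermost, used to freeze one sensor and integrate over the others.
-/
theorem lintegral_pi_succAbove {n : ℕ} (ν : Fin (n + 1) → Measure ℝ) [∀ l, SigmaFinite (ν l)]
    (i : Fin (n + 1)) (G : ℝ × (Fin n → ℝ) → ℝ≥0∞) (hG : Measurable G) :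
    ∫⁻ x, G (x i, fun l => x (i.succAbove l)) ∂(Measure.pi ν)
      = ∫⁻ t, ∫⁻ z, G (t, z) ∂(Measure.pi fun l => ν (i.succAbove l)) ∂(ν i) := by
  rw [← lintegral_prod _ hG.aemeasurable,
    ← (measurePreserving_piFinSuccAbove ν i).lintegral_comp hG]
  rfl

theorem lintegral_pi_prod {n : ℕ} (ν : Fin n → Measure ℝ) [∀ l, SigmaFinite (ν l)]
    (f : Fin n → ℝ → ℝ≥0∞) (hf : ∀ l, Measurable (f l)) :
    ∫⁻ x, ∏ l, f l (x l) ∂(Measure.pi ν) = ∏ l, ∫⁻ t, f l t ∂(ν l) := by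
  induction n with
  | zero => simp
  | succ n ih =>
    have := lintegral_pi_succAbove ν 0 (fun p => f 0 p.1 * ∏ l : Fin n, f l.succ (p.2 l))
      (by fun_prop)
    simp only [Fin.zero_succAbove] at this
    simp only [Fin.prod_univ_succ]
    rw [this, ← ih (fun l => ν l.succ) (fun l => f l.succ) fun l => hf _,
      ← lintegral_mul_const _ (hf 0)]
    refine lintegral_congr fun t => ?_
    rw [lintegral_const_mul _ (by fun_prop)]

theorem measurable_cellIndex (k : ℕ) : Measurable (cellIndex k) := by
  unfold cellIndex
  fun_prop

/-- The `j`-th of `k` subintervals of the unit interval. -/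
def cell (k j : ℕ) : Set ℝ := {t | cellIndex k t = j} ∩ Set.Icc 0 1

theorem measurableSet_cellIndex_eq (k j : ℕ) : MeasurableSet {t | cellIndex k t = j} :=
  measurable_cellIndex k (measurableSet_singleton j)

theorem cell_ae_eq {k j : ℕ} (hj : j < k) :
    cell k j =ᵐ[volume] Set.Icc ((j : ℝ) / k) ((j + 1) / k) := by
  have hk : (0 : ℝ) < k := by exact_mod_cast (Nat.zero_le j).trans_lt hj
  have hjk : (j : ℝ) + 1 ≤ k := by exact_mod_cast hj
  have h1 : cell k j ⊆ Set.Icc ((j : ℝ) / k) ((j + 1) / k) := by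
    rintro t ⟨ht, ht0, ht1⟩
    rw [Set.mem_ofPred_eq] at ht
    have h1 := cellIndex_le (k := k) ht0
    have h2 := le_cellIndex_add_one (k := k) ht1
    rw [ht] at h1 h2
    rw [Set.mem_Icc, div_le_iff₀ hk, le_div_iff₀ hk]
    constructor <;> linarith
  have h2 : Set.Ioo ((j : ℝ) / k) ((j + 1) / k) ⊆ cell k j := by
    rintro t ⟨ht0, ht1⟩
    rw [div_lt_iff₀ hk] at ht0
    rw [lt_div_iff₀ hk] at ht1
    have ht : 0 ≤ t := by
      have : (0 : ℝ) ≤ j := by positivity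
      by_contra! h
      nlinarith
    refine ⟨?_, ht, ?_⟩
    · have : ⌊(k : ℝ) * t⌋₊ = j := by
        rw [Nat.floor_eq_iff (by positivity)]
        constructor <;> linarith
      rw [Set.mem_ofPred_eq, cellIndex, this]
      exact min_eq_left (by omega)
    · by_contra! h
      nlinarith
  exact h1.eventuallyLE.antisymm (Ioo_ae_eq_Icc.symm.le.trans h2.eventuallyLE)

theorem volume_cell {k j : ℕ} (hj : j < k) : volume (cell k j) = ENNReal.ofReal (1 / k) := by
  rw [measure_congr (cell_ae_eq hj), Real.volume_Icc]
  congr 1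
  ring

instance (k j : ℕ) : IsFiniteMeasure (volume.restrict (cell k j)) :=
  isFiniteMeasure_restrict.2
    ((measure_mono Set.inter_subset_right).trans_lt (by simp)).ne

/-- Chernoff bound for a centred Bernoulli variable. -/
theorem bernoulli_exp_le {u lam : ℝ} (hu0 : 0 ≤ u) (hu1 : u ≤ 1) (hl : |lam| ≤ 1) :
    u * Real.exp (lam * (1 - u)) + (1 - u) * Real.exp (lam * (0 - u)) ≤ Real.exp (lam ^ 2) := by
  -- The linear terms cancel on averaging over the two centred values, leaving `1 + λ² ≤ exp(λ²)`.
  have key : ∀ v : ℝ, |v| ≤ 1 → Real.exp (lam * v) ≤ 1 + lam * v + lam ^ 2 := by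
    intro v hv
    have h1 : |lam * v| ≤ 1 := by
      rw [abs_mul]
      exact mul_le_one₀ hl (abs_nonneg _) hv
    have h2 := (abs_le.1 (Real.abs_exp_sub_one_sub_id_le h1)).2
    have h3 : (lam * v) ^ 2 ≤ lam ^ 2 := by
      rw [mul_pow]
      have : v ^ 2 ≤ 1 := by rwa [sq_le_one_iff_abs_le_one]
      nlinarith [sq_nonneg lam]
    linarith
  have h1 := key (1 - u) (abs_le.2 ⟨by linarith, by linarith⟩)
  have h2 := key (0 - u) (abs_le.2 ⟨by linarith, by linarith⟩)
  have h3 := Real.add_one_le_exp (lam ^ 2)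
  nlinarith [mul_le_mul_of_nonneg_left h1 hu0, mul_le_mul_of_nonneg_left h2 (sub_nonneg.2 hu1)]

/-- One factor of the rank's exponential moment: another sensor `s` of the cell is left of `t` with
conditional probability `k t - j`. Overlapping half-lines at `s = t` absorb any tie-breaking rule
`q`, at the cost of a null set. -/
theorem lintegral_cell_exp_le {k j : ℕ} (hj : j < k) {lam t : ℝ} (hl : |lam| ≤ 1)
    (ht : t ∈ Set.Icc ((j : ℝ) / k) ((j + 1) / k)) (q : Prop) [Decidable q] :
    ∫⁻ s in cell k j, ENNReal.ofReal
        (Real.exp (lam * ((if s < t ∨ (s = t ∧ q) then 1 else 0) - (k * t - j))))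
      ≤ volume (cell k j) * ENNReal.ofReal (Real.exp (lam ^ 2)) := by
  have hk : (0 : ℝ) < k := by exact_mod_cast (Nat.zero_le j).trans_lt hj
  obtain ⟨ht0, ht1⟩ := ht
  have hu0 : 0 ≤ k * t - j := by
    rw [div_le_iff₀ hk] at ht0; linarith
  have hu1 : k * t - j ≤ 1 := by
    rw [le_div_iff₀ hk] at ht1; linarith
  set u := k * t - j with hu
  rw [setLIntegral_congr (cell_ae_eq hj)]
  calc ∫⁻ s in Set.Icc ((j : ℝ) / k) ((j + 1) / k), ENNReal.ofReal
        (Real.exp (lam * ((if s < t ∨ (s = t ∧ q) then 1 else 0) - u)))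
      ≤ ∫⁻ s in Set.Icc ((j : ℝ) / k) ((j + 1) / k),
        ((Set.Iic t).indicator (fun _ => ENNReal.ofReal (Real.exp (lam * (1 - u)))) s
          + (Set.Ici t).indicator (fun _ => ENNReal.ofReal (Real.exp (lam * (0 - u)))) s) := by
        refine lintegral_mono fun s => ?_
        split_ifs with h
        · have : s ∈ Set.Iic t := h.elim le_of_lt fun h => h.1.le
          simp only [Set.indicator_of_mem this]
          exact le_self_add
        · have : s ∈ Set.Ici t := not_lt.1 fun h' => h (Or.inl h')
          simp only [Set.indicator_of_mem this]
          exact le_add_self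
    _ = ENNReal.ofReal (Real.exp (lam * (1 - u)))
          * volume (Set.Iic t ∩ Set.Icc ((j : ℝ) / k) ((j + 1) / k))
        + ENNReal.ofReal (Real.exp (lam * (0 - u)))
          * volume (Set.Ici t ∩ Set.Icc ((j : ℝ) / k) ((j + 1) / k)) := by
        rw [lintegral_add_left (measurable_const.indicator measurableSet_Iic),
          lintegral_indicator_const measurableSet_Iic, lintegral_indicator_const measurableSet_Ici,
          Measure.restrict_apply measurableSet_Iic, Measure.restrict_apply measurableSet_Ici]
    _ ≤ ENNReal.ofReal (Real.exp (lam * (1 - u))) * ENNReal.ofReal (u / k)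
        + ENNReal.ofReal (Real.exp (lam * (0 - u))) * ENNReal.ofReal ((1 - u) / k) := by
        gcongr
        · calc _ ≤ volume (Set.Icc ((j : ℝ) / k) t) := measure_mono fun s hs => ⟨hs.2.1, hs.1⟩
            _ = _ := by
              rw [Real.volume_Icc, hu]
              congr 1
              field_simp
        · calc _ ≤ volume (Set.Icc t ((j + 1) / k)) := measure_mono fun s hs => ⟨hs.1, hs.2.2⟩
            _ = _ := by
              rw [Real.volume_Icc, hu]
              congr 1
              field_simp
              ring
    _ ≤ _ := by
        have hu1' : 0 ≤ 1 - u := sub_nonneg.2 hu1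
        rw [volume_cell hj, ← ENNReal.ofReal_mul (by positivity),
          ← ENNReal.ofReal_mul (by positivity), ← ENNReal.ofReal_mul (by positivity),
          ← ENNReal.ofReal_add (by positivity) (by positivity)]
        refine ENNReal.ofReal_le_ofReal ?_
        have := mul_le_mul_of_nonneg_left (bernoulli_exp_le hu0 hu1 hl)
          (show 0 ≤ 1 / (k : ℝ) by positivity)
        refine le_trans (le_of_eq ?_) this
        ring

/-- The joint law of `n` independent sensors that are uniform on the unit interval. -/
def unitLaw (n : ℕ) : Measure (Fin n → ℝ) :=
  Measure.pi fun _ => volume.restrict (Set.Icc (0 : ℝ) 1)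

/-- The placements in which each sensor `l` lies in the cell `c l`. -/
def assigned {n : ℕ} (k : ℕ) (c : Fin n → ℕ) : Set (Fin n → ℝ) :=
  Set.univ.pi fun l => {t | cellIndex k t = c l}

theorem measurableSet_assigned {n : ℕ} (k : ℕ) (c : Fin n → ℕ) :
    MeasurableSet (assigned k c) :=
  MeasurableSet.univ_pi fun _ => measurableSet_cellIndex_eq k _

/-- Prescribing every sensor's cell is a product event, so independence survives the conditioning.
-/
theorem unitLaw_restrict_assigned {n : ℕ} (k : ℕ) (c : Fin n → ℕ) :
    (unitLaw n).restrict (assigned k c) = Measure.pi fun l => volume.restrict (cell k (c l)) := by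
  rw [unitLaw, assigned, Measure.restrict_pi_pi]
  congr 1
  ext1 l
  rw [Measure.restrict_restrict (measurableSet_cellIndex_eq k _)]
  rfl

theorem unitLaw_assigned {n : ℕ} (k : ℕ) (c : Fin n → ℕ) :
    unitLaw n (assigned k c) = ∏ l, volume (cell k (c l)) := by
  rw [← Measure.restrict_apply_univ, unitLaw_restrict_assigned, Measure.pi_univ]
  simp

/-! ### Exponential moments of ranks and displacements. -/

theorem rank_eq_sum {n : ℕ} (x : Fin (n + 1) → ℝ) (S : Finset (Fin (n + 1))) (i : Fin (n + 1)) :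
    (rank x S i : ℝ) = ∑ l : Fin n, if i.succAbove l ∈ S then
      (if x (i.succAbove l) < x i ∨ (x (i.succAbove l) = x i ∧ i.succAbove l < i)
        then (1 : ℝ) else 0) else 0 := by
  have h1 : (rank x S i : ℝ) = ∑ l ∈ S, if x l < x i ∨ (x l = x i ∧ l < i) then (1 : ℝ) else 0 := by
    rw [rank, Finset.card_filter]
    push_cast
    rfl
  have h2 : (∑ l ∈ S, if x l < x i ∨ (x l = x i ∧ l < i) then (1 : ℝ) else 0)
      = ∑ l, if l ∈ S then (if x l < x i ∨ (x l = x i ∧ l < i) then (1 : ℝ) else 0) else 0 := by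
    rw [← Finset.sum_filter]
    simp
  rw [h1, h2, Fin.sum_univ_succAbove _ i]
  simp

theorem card_eq_sum_succAbove {n : ℕ} {S : Finset (Fin (n + 1))} {i : Fin (n + 1)} (hi : i ∈ S) :
    (S.card : ℝ) = 1 + ∑ l : Fin n, if i.succAbove l ∈ S then (1 : ℝ) else 0 := by
  have : (S.card : ℝ) = ∑ l, if l ∈ S then (1 : ℝ) else 0 := by simp
  rw [this, Fin.sum_univ_succAbove _ i, if_pos hi]

/-- Subtracting `u` once for each member of `S` centres the indicator of each other sensor; sensor
`i` itself contributes only `1/2 - u`. -/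
theorem exp_rank_eq_prod {n : ℕ} (x : Fin (n + 1) → ℝ) {S : Finset (Fin (n + 1))}
    {i : Fin (n + 1)} (hi : i ∈ S) (lam u : ℝ) :
    ENNReal.ofReal (Real.exp (lam * (rank x S i + 1 / 2 - S.card * u)))
      = ENNReal.ofReal (Real.exp (lam * (1 / 2 - u))) * ∏ l : Fin n, if i.succAbove l ∈ S then
          ENNReal.ofReal (Real.exp (lam * ((if x (i.succAbove l) < x i ∨
            (x (i.succAbove l) = x i ∧ i.succAbove l < i) then 1 else 0) - u))) else 1 := by
  have : lam * (rank x S i + 1 / 2 - S.card * u) = lam * (1 / 2 - u)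
      + ∑ l : Fin n, if i.succAbove l ∈ S then (lam * ((if x (i.succAbove l) < x i ∨
            (x (i.succAbove l) = x i ∧ i.succAbove l < i) then 1 else 0) - u)) else 0 := by
    rw [rank_eq_sum, card_eq_sum_succAbove hi]
    have : ∀ A B D : ℝ, A - B * u = D → lam * (A + 1 / 2 - (1 + B) * u) = lam * (1 / 2 - u)
        + lam * D := by
      rintro A B D rfl
      ring
    rw [this _ _ (∑ l : Fin n, if i.succAbove l ∈ S then ((if x (i.succAbove l) < x i ∨
      (x (i.succAbove l) = x i ∧ i.succAbove l < i) then 1 else 0) - u) else 0)]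
    · rw [Finset.mul_sum]
      simp only [mul_ite, mul_zero]
    · rw [Finset.sum_mul, ← Finset.sum_sub_distrib]
      refine Finset.sum_congr rfl fun l _ => ?_
      split_ifs <;> ring
  rw [this, Real.exp_add, ENNReal.ofReal_mul (Real.exp_pos _).le, Real.exp_sum,
    ENNReal.ofReal_prod_of_nonneg fun _ _ => (Real.exp_pos _).le]
  congr 1
  refine Finset.prod_congr rfl fun l _ => ?_
  split_ifs <;> simp

theorem measurableSet_lex {β : Type*} [MeasurableSpace β] {g h : β → ℝ} (hg : Measurable g)
    (hh : Measurable h) (q : Prop) : MeasurableSet {b | g b < h b ∨ (g b = h b ∧ q)} :=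
  (measurableSet_lt hg hh).union ((measurableSet_eq_fun hg hh).inter (MeasurableSet.const q))

/-- Exponential moment of the centred rank of a sensor among the sensors of its cell. -/
theorem lintegral_exp_rank_le {n k : ℕ} {c : Fin n → ℕ} (hc : ∀ l, c l < k)
    {S : Finset (Fin n)} {i : Fin n} (hi : i ∈ S) (hS : ∀ l ∈ S, c l = c i)
    {lam : ℝ} (hl : |lam| ≤ 1) :
    ∫⁻ x in assigned k c, ENNReal.ofReal
        (Real.exp (lam * (rank x S i + 1 / 2 - S.card * (k * x i - c i)))) ∂unitLaw n
      ≤ unitLaw n (assigned k c) * ENNReal.ofReal (Real.exp (S.card * lam ^ 2 + 1)) := by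
  obtain ⟨n, rfl⟩ : ∃ n', n = n' + 1 := ⟨n - 1, by have := i.pos; omega⟩
  have hk : (0 : ℝ) < k := by exact_mod_cast (Nat.zero_le _).trans_lt (hc i)
  set E := ENNReal.ofReal (Real.exp (lam ^ 2)) with hE
  have hE1 : 1 ≤ E := by
    rw [hE, ENNReal.one_le_ofReal]
    exact Real.one_le_exp (sq_nonneg _)
  set G : ℝ × (Fin n → ℝ) → ℝ≥0∞ := fun p =>
    ENNReal.ofReal (Real.exp (lam * (1 / 2 - (k * p.1 - c i)))) *
      ∏ l : Fin n, if i.succAbove l ∈ S then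
        ENNReal.ofReal (Real.exp (lam * ((if p.2 l < p.1 ∨
          (p.2 l = p.1 ∧ i.succAbove l < i) then 1 else 0) - (k * p.1 - c i)))) else 1 with hG
  have hGm : Measurable G := by
    refine Measurable.mul (by fun_prop) (Finset.measurable_prod _ fun l _ => ?_)
    split_ifs with hlS
    swap
    · exact measurable_const
    have : Measurable fun p : ℝ × (Fin n → ℝ) =>
        if p.2 l < p.1 ∨ (p.2 l = p.1 ∧ i.succAbove l < i) then (1 : ℝ) else 0 := by
      exact Measurable.ite (measurableSet_lex (by fun_prop) (by fun_prop) _)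
        measurable_const measurable_const
    fun_prop
  simp only [exp_rank_eq_prod _ hi]
  rw [unitLaw_restrict_assigned, unitLaw_assigned]
  calc _ = ∫⁻ t in cell k (c i), ∫⁻ z, G (t, z)
        ∂(Measure.pi fun l => volume.restrict (cell k (c (i.succAbove l)))) :=
        lintegral_pi_succAbove (fun l => volume.restrict (cell k (c l))) i G hGm
    _ ≤ ∫⁻ t in cell k (c i), ENNReal.ofReal (Real.exp 1) *
          ∏ l : Fin n, (volume (cell k (c (i.succAbove l))) *
            if i.succAbove l ∈ S then E else 1) := by
        -- Both sides pass to the closed interval, where `t` satisfies the bounds that the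
        -- one-factor estimate needs.
        rw [setLIntegral_congr (cell_ae_eq (hc i)), setLIntegral_congr (cell_ae_eq (hc i))]
        refine setLIntegral_mono' measurableSet_Icc fun t ht => ?_
        rw [hG]
        dsimp only
        have hm : ∀ l : Fin n, Measurable fun s : ℝ => if i.succAbove l ∈ S then
            ENNReal.ofReal (Real.exp (lam * ((if s < t ∨
              (s = t ∧ i.succAbove l < i) then 1 else 0) - (k * t - c i)))) else 1 := by
          intro l
          split_ifs with hlS
          swap
          · exact measurable_const
          have : Measurable fun s : ℝ =>
              if s < t ∨ (s = t ∧ i.succAbove l < i) then (1 : ℝ) else 0 := by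
            exact Measurable.ite (measurableSet_lex measurable_id measurable_const _)
              measurable_const measurable_const
          fun_prop
        have := ht.1
        have := ht.2
        rw [lintegral_const_mul _ (by
            exact Finset.measurable_prod _ fun l _ => (hm l).comp (measurable_pi_apply l)),
          lintegral_pi_prod _ _ hm]
        refine mul_le_mul' (ENNReal.ofReal_le_ofReal (Real.exp_le_exp.2 ?_))
          (Finset.prod_le_prod' fun l _ => ?_)
        · have h1 : |1 / 2 - (k * t - c i)| ≤ 1 := by
            rw [div_le_iff₀ hk] at *
            rw [le_div_iff₀ hk] at *
            rw [abs_le]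
            constructor <;> linarith
          refine (le_abs_self _).trans ?_
          rw [abs_mul]
          exact mul_le_one₀ hl (abs_nonneg _) h1
        · split_ifs with hlS
          · rw [hS _ hlS]
            exact lintegral_cell_exp_le (hc i) hl ht _
          · simp
    _ = volume (cell k (c i)) * (∏ l : Fin n, volume (cell k (c (i.succAbove l)))) *
          (ENNReal.ofReal (Real.exp 1) * ∏ l : Fin n, if i.succAbove l ∈ S then E else 1) := by
        rw [lintegral_const, Measure.restrict_apply_univ, Finset.prod_mul_distrib]
        ring
    _ ≤ _ := by
        rw [← Fin.prod_univ_succAbove (fun l => volume (cell k (c l))) i]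
        refine mul_le_mul' le_rfl ?_
        calc ENNReal.ofReal (Real.exp 1) * ∏ l : Fin n, (if i.succAbove l ∈ S then E else 1)
            ≤ ENNReal.ofReal (Real.exp 1) * ∏ l, (if l ∈ S then E else 1) := by
              -- A spare factor `E ≥ 1` for sensor `i` rounds the exponent `S.card - 1` up to
              -- `S.card`.
              rw [Fin.prod_univ_succAbove _ i, if_pos hi]
              exact mul_le_mul' le_rfl (le_mul_of_one_le_left' hE1)
          _ = _ := by
              rw [Finset.prod_ite_mem, Finset.univ_inter, Finset.prod_const, hE,
                ← ENNReal.ofReal_pow (Real.exp_pos _).le, ← ENNReal.ofReal_mul (Real.exp_pos _).le,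
                ← Real.exp_nat_mul, ← Real.exp_add, add_comm]

theorem lintegral_exp_displacement_le {n k m : ℕ} {c : Fin n → ℕ} (hc : ∀ l, c l < k)
    {T : Finset (Fin n)} {i : Fin n} (hi : i ∈ T)
    (hm : (T.filter fun l => c l = c i).card = m) {lam : ℝ} (hl : |lam| ≤ 1) :
    ∫⁻ x in assigned k c, ENNReal.ofReal
        (Real.exp (lam * (k * m * (moveChosen k m x T i - x i)))) ∂unitLaw n
      ≤ unitLaw n (assigned k c) * ENNReal.ofReal (Real.exp (m * lam ^ 2 + 1)) := by
  have hiS : i ∈ T.filter fun l => c l = c i := Finset.mem_filter.2 ⟨hi, rfl⟩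
  have hk : (k : ℝ) ≠ 0 := by have := hc i; norm_cast; omega
  have hm0 : (m : ℝ) ≠ 0 := by
    rw [← hm]
    exact_mod_cast (Finset.card_pos.2 ⟨i, hiS⟩).ne'
  have := lintegral_exp_rank_le hc hiS (fun l hl => (Finset.mem_filter.1 hl).2) hl
  rw [hm] at this
  refine le_trans (le_of_eq ?_) this
  refine setLIntegral_congr_fun (measurableSet_assigned k c) fun x hx => ?_
  have hx' : ∀ l, cellIndex k (x l) = c l := fun l => hx l trivial
  have hS : inCell k x T (c i) = T.filter fun l => c l = c i := by
    simp only [inCell, hx']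
  rw [moveChosen_of_mem hi, hx' i, hS]
  congr 3
  field_simp
  ring

theorem measurableSet_hasCell {n : ℕ} (k : ℕ) (l : Fin n) (j : ℕ) :
    MeasurableSet {x : Fin n → ℝ | cellIndex k (x l) = j} :=
  ((measurable_cellIndex k).comp (measurable_pi_apply l)) (measurableSet_singleton j)

theorem measurable_card_inCell {n : ℕ} (k : ℕ) (T : Finset (Fin n)) (j : ℕ) :
    Measurable fun x : Fin n → ℝ => (inCell k x T j).card := by
  simp only [inCell, Finset.card_filter]
  exact Finset.measurable_sum _ fun l _ =>
    Measurable.ite (measurableSet_hasCell k l j) measurable_const measurable_const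

theorem measurable_moveChosen {n : ℕ} (k m : ℕ) (T : Finset (Fin n)) (i : Fin n) :
    Measurable fun x : Fin n → ℝ => moveChosen k m x T i := by
  have hcell : ∀ l : Fin n, Measurable fun x : Fin n → ℝ => cellIndex k (x l) :=
    fun l => (measurable_cellIndex k).comp (measurable_pi_apply l)
  have hrank : Measurable fun x : Fin n → ℝ => rank x (inCell k x T (cellIndex k (x i))) i := by
    simp only [rank, inCell, Finset.filter_filter, Finset.card_filter]
    exact Finset.measurable_sum _ fun l _ => Measurable.ite
      ((measurableSet_eq_fun (hcell l) (hcell i)).inter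
        (measurableSet_lex (measurable_pi_apply l) (measurable_pi_apply i) _))
      measurable_const measurable_const
  have hrank' : Measurable fun x : Fin n → ℝ =>
      (rank x (inCell k x T (cellIndex k (x i))) i : ℝ) := measurable_from_top.comp hrank
  have hcell' : Measurable fun x : Fin n → ℝ => (cellIndex k (x i) : ℝ) :=
    measurable_from_top.comp (hcell i)
  unfold moveChosen
  split_ifs
  · fun_prop
  · fun_prop

theorem measurable_abs_displacement {n : ℕ} (a : ℝ) (k m : ℕ) (T : Finset (Fin n)) (i : Fin n) :
    Measurable fun x : Fin n → ℝ => ENNReal.ofReal (|x i - moveChosen k m x T i| ^ a) := by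
  have := measurable_moveChosen k m T i
  have h : Measurable fun x : Fin n → ℝ => |x i - moveChosen k m x T i| :=
    ((measurable_pi_apply i).sub this).abs
  fun_prop

/-! ### From exponential moments to `a`-th moments. -/

theorem rpow_le_mul_exp {a z : ℝ} (ha : 0 < a) (hz : 0 ≤ z) : z ^ a ≤ a ^ a * Real.exp z := by
  have h1 : z / a ≤ Real.exp (z / a) := by linarith [Real.add_one_le_exp (z / a)]
  calc z ^ a = (a * (z / a)) ^ a := by rw [mul_div_cancel₀ _ ha.ne']
    _ = a ^ a * (z / a) ^ a := Real.mul_rpow ha.le (by positivity)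
    _ ≤ a ^ a * Real.exp (z / a) ^ a := by gcongr
    _ = a ^ a * Real.exp z := by rw [← Real.exp_mul, div_mul_cancel₀ _ ha.ne']

theorem exp_abs_le (z : ℝ) : Real.exp |z| ≤ Real.exp z + Real.exp (-z) := by
  rcases abs_cases z with ⟨h, _⟩ | ⟨h, _⟩ <;> rw [h] <;> linarith [Real.exp_pos z, Real.exp_pos (-z)]

/-- The `a`-th moment of the displacement of a chosen sensor. -/
theorem lintegral_displacement_rpow_le {a : ℝ} (ha : 0 < a) {n k m : ℕ} {c : Fin n → ℕ}
    (hc : ∀ l, c l < k) {T : Finset (Fin n)} {i : Fin n} (hi : i ∈ T)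
    (hm : (T.filter fun l => c l = c i).card = m) :
    ∫⁻ x in assigned k c, ENNReal.ofReal (|x i - moveChosen k m x T i| ^ a) ∂unitLaw n
      ≤ unitLaw n (assigned k c) *
        ENNReal.ofReal (2 * a ^ a * Real.exp 2 * (√m / (k * m)) ^ a) := by
  have hk : (0 : ℝ) < k := by exact_mod_cast (Nat.zero_le _).trans_lt (hc i)
  have hm1 : 1 ≤ m := by
    rw [← hm]
    exact Finset.card_pos.2 ⟨i, Finset.mem_filter.2 ⟨hi, rfl⟩⟩
  have hm1' : (1 : ℝ) ≤ m := by exact_mod_cast hm1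
  have hm0 : (0 : ℝ) < m := by linarith
  have hs : 0 < √(m : ℝ) := Real.sqrt_pos.2 hm0
  have hs1 : 1 ≤ √(m : ℝ) := Real.one_le_sqrt.2 hm1'
  -- Inverse standard-deviation scale: the exponent `m λ² + 1` becomes the constant `2`.
  set lam := 1 / √(m : ℝ) with hlam
  have hl0 : 0 < lam := by positivity
  have hl : |lam| ≤ 1 := by
    rw [abs_of_pos hl0, hlam, div_le_one hs]
    exact hs1
  have hl' : |(-lam)| ≤ 1 := by rwa [abs_neg]
  have hlm : m * lam ^ 2 + 1 = 2 := by
    rw [hlam, div_pow, Real.sq_sqrt hm0.le]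
    field_simp
    norm_num
  set D := a ^ a * (√m / (k * m)) ^ a with hD
  have hD0 : 0 ≤ D := by positivity
  set W : (Fin n → ℝ) → ℝ := fun x => k * m * (moveChosen k m x T i - x i) with hW
  have hWm : Measurable W := by
    have := measurable_moveChosen k m T i
    fun_prop
  have key : ∀ x, ENNReal.ofReal (|x i - moveChosen k m x T i| ^ a)
      ≤ ENNReal.ofReal D * (ENNReal.ofReal (Real.exp (lam * W x))
        + ENNReal.ofReal (Real.exp (-lam * W x))) := by
    intro x
    rw [← ENNReal.ofReal_add (Real.exp_pos _).le (Real.exp_pos _).le, ← ENNReal.ofReal_mul hD0]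
    refine ENNReal.ofReal_le_ofReal ?_
    have h1 : |x i - moveChosen k m x T i| = √m / (k * m) * |lam * W x| := by
      rw [hW, abs_mul, abs_mul, abs_of_pos hl0, abs_of_pos (mul_pos hk hm0), abs_sub_comm, hlam]
      field_simp
    rw [h1, Real.mul_rpow (by positivity) (abs_nonneg _)]
    calc (√m / (k * m)) ^ a * |lam * W x| ^ a
        ≤ (√m / (k * m)) ^ a * (a ^ a * (Real.exp (lam * W x) + Real.exp (-(lam * W x)))) := by
          gcongr
          refine (rpow_le_mul_exp ha (abs_nonneg _)).trans ?_
          gcongr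
          exact exp_abs_le _
      _ = _ := by
        rw [hD, neg_mul]
        ring
  calc _ ≤ ∫⁻ x in assigned k c, ENNReal.ofReal D * (ENNReal.ofReal (Real.exp (lam * W x))
        + ENNReal.ofReal (Real.exp (-lam * W x))) ∂unitLaw n := lintegral_mono key
    _ ≤ ENNReal.ofReal D * (unitLaw n (assigned k c) * ENNReal.ofReal (Real.exp 2)
        + unitLaw n (assigned k c) * ENNReal.ofReal (Real.exp 2)) := by
        rw [lintegral_const_mul _ (by fun_prop), lintegral_add_left (by fun_prop)]
        gcongr
        · have := lintegral_exp_displacement_le hc hi hm hl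
          rwa [hlm] at this
        · have := lintegral_exp_displacement_le hc hi hm hl'
          rwa [neg_sq, hlm] at this
    _ = _ := by
        rw [← mul_add, ← ENNReal.ofReal_add (Real.exp_pos _).le (Real.exp_pos _).le, mul_left_comm,
          ← ENNReal.ofReal_mul hD0, hD]
        congr 2
        ring

instance (n : ℕ) : IsProbabilityMeasure (unitLaw n) := by
  have : IsProbabilityMeasure (volume.restrict (Set.Icc (0 : ℝ) 1)) := ⟨by simp⟩
  unfold unitLaw
  infer_instance

theorem ae_mem_unit (n : ℕ) : ∀ᵐ x ∂unitLaw n, ∀ i, x i ∈ Set.Icc (0 : ℝ) 1 := by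
  rw [ae_all_iff]
  intro i
  exact (Measure.tendsto_eval_ae_ae (i := i)).eventually (ae_restrict_mem measurableSet_Icc)

/-- On an arbitrary event, the `a`-th moment of the displacement towards equidistant positions. -/
theorem setLIntegral_equidistant_rpow_le {a : ℝ} (ha : 0 < a) {n : ℕ} (hn : IsLarge a n)
    (A : Set (Fin n → ℝ)) (i : Fin n) :
    ∫⁻ x in A, ENNReal.ofReal (|x i - moveChosen 1 n x Finset.univ i| ^ a) ∂unitLaw n
      ≤ ENNReal.ofReal (((1 + a) * √(Real.log n / n)) ^ a) * unitLaw n A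
        + ENNReal.ofReal (2 * Real.exp 1 * (n : ℝ) ^ (-a)) := by
  have hn0 : (0 : ℝ) < n := by exact_mod_cast hn.pos
  have hL : 0 < Real.log n := by linarith [hn.two_le_log]
  set L := Real.log n with hLdef
  -- Now `n λ² = log n`: deviations beyond `(1 + a) λ` carry a weight polynomially small in `n`.
  set lam := √(L / n) with hlam
  have hl0 : 0 < lam := Real.sqrt_pos.2 (by positivity)
  have hsq : lam ^ 2 = L / n := Real.sq_sqrt (by positivity)
  have hl : |lam| ≤ 1 := by
    rw [abs_of_pos hl0, hlam, Real.sqrt_le_iff, one_pow, div_le_one hn0]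
    refine ⟨zero_le_one, ?_⟩
    linarith [Real.log_le_sub_one_of_pos hn0]
  have hl' : |(-lam)| ≤ 1 := by rwa [abs_neg]
  have hnl : n * lam ^ 2 + 1 = L + 1 := by rw [hsq, mul_div_cancel₀ _ hn0.ne']
  -- `D` makes the exponential term at least `1` when the displacement exceeds `(1 + a) λ`, while
  -- its expectation is at most `2 D exp(L + 1) = 2e n^(-a)`. The bound is pointwise almost
  -- everywhere, so no independence from the event `A` is needed.
  set D := Real.exp (-((1 + a) * L)) with hD
  have hD0 : 0 ≤ D := (Real.exp_pos _).le
  set W : (Fin n → ℝ) → ℝ := fun x => (1 : ℕ) * n * (moveChosen 1 n x Finset.univ i - x i) with hW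
  have hWm : Measurable W := by
    have := measurable_moveChosen 1 n Finset.univ i
    fun_prop
  have key : ∀ x : Fin n → ℝ, (∀ i, x i ∈ Set.Icc (0 : ℝ) 1) →
      ENNReal.ofReal (|x i - moveChosen 1 n x Finset.univ i| ^ a)
      ≤ ENNReal.ofReal (((1 + a) * lam) ^ a) +
        ENNReal.ofReal D * (ENNReal.ofReal (Real.exp (lam * W x))
        + ENNReal.ofReal (Real.exp (-lam * W x))) := by
    intro x hx
    rw [← ENNReal.ofReal_add (Real.exp_pos _).le (Real.exp_pos _).le, ← ENNReal.ofReal_mul hD0,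
      ← ENNReal.ofReal_add (by positivity) (by positivity)]
    refine ENNReal.ofReal_le_ofReal ?_
    have hW' : lam * |W x| = lam * n * |x i - moveChosen 1 n x Finset.univ i| := by
      rw [hW, abs_mul, Nat.cast_one, one_mul, abs_of_pos hn0, abs_sub_comm, mul_assoc]
    have hy := moveChosen_mem_unit (T := Finset.univ) one_pos hn.pos (fun j hj => by
      obtain rfl : j = 0 := by omega
      rw [inCell_one_univ]
      simp) hx i
    have hd : |x i - moveChosen 1 n x Finset.univ i| ≤ 1 := by
      rw [abs_le]
      constructor <;> linarith [(hx i).1, (hx i).2, hy.1, hy.2]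
    rcases le_total |x i - moveChosen 1 n x Finset.univ i| ((1 + a) * lam) with h | h
    · have h1 : |x i - moveChosen 1 n x Finset.univ i| ^ a ≤ ((1 + a) * lam) ^ a := by gcongr
      have : 0 ≤ D * (Real.exp (lam * W x) + Real.exp (-lam * W x)) := by positivity
      linarith
    · have h1 : |x i - moveChosen 1 n x Finset.univ i| ^ a ≤ 1 :=
        Real.rpow_le_one (abs_nonneg _) hd ha.le
      have h2 : (1 + a) * L ≤ |lam * W x| := by
        rw [abs_mul, abs_of_pos hl0, hW']
        calc (1 + a) * L = lam * n * ((1 + a) * lam) := by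
              have : lam * n * ((1 + a) * lam) = (1 + a) * (n * lam ^ 2) := by ring
              rw [this, hsq, mul_div_cancel₀ _ hn0.ne']
          _ ≤ _ := by gcongr
      have h3 : 1 ≤ D * (Real.exp (lam * W x) + Real.exp (-lam * W x)) := by
        calc 1 = D * Real.exp ((1 + a) * L) := by rw [hD, ← Real.exp_add]; simp
          _ ≤ D * Real.exp |lam * W x| := by gcongr
          _ ≤ _ := by
            rw [neg_mul]
            gcongr
            exact exp_abs_le _
      have : 0 ≤ ((1 + a) * lam) ^ a := by positivity
      linarith
  have hassigned : assigned 1 (fun _ : Fin n => 0) = Set.univ := by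
    ext x
    simp [assigned, cellIndex_one]
  have hexp : ∀ s : ℝ, |s| ≤ 1 → s ^ 2 = lam ^ 2 →
      ∫⁻ x, ENNReal.ofReal (Real.exp (s * W x)) ∂unitLaw n ≤ ENNReal.ofReal (Real.exp (L + 1)) := by
    intro s hs1 hs2
    have := lintegral_exp_displacement_le (k := 1) (m := n) (c := fun _ : Fin n => 0)
      (fun _ => one_pos) (Finset.mem_univ i) (by simp) hs1
    rw [hassigned, setLIntegral_univ, measure_univ, one_mul, hs2, hnl] at this
    exact this
  calc _ ≤ ∫⁻ x in A, (ENNReal.ofReal (((1 + a) * lam) ^ a) +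
        ENNReal.ofReal D * (ENNReal.ofReal (Real.exp (lam * W x))
        + ENNReal.ofReal (Real.exp (-lam * W x)))) ∂unitLaw n :=
        lintegral_mono_ae (ae_restrict_of_ae ((ae_mem_unit n).mono key))
    _ = ENNReal.ofReal (((1 + a) * lam) ^ a) * unitLaw n A +
        ∫⁻ x in A, ENNReal.ofReal D * (ENNReal.ofReal (Real.exp (lam * W x))
        + ENNReal.ofReal (Real.exp (-lam * W x))) ∂unitLaw n := by
        rw [lintegral_add_left measurable_const, lintegral_const, Measure.restrict_apply_univ]
    _ ≤ ENNReal.ofReal (((1 + a) * lam) ^ a) * unitLaw n A +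
        ENNReal.ofReal D * (ENNReal.ofReal (Real.exp (L + 1)) + ENNReal.ofReal (Real.exp (L + 1))) := by
        gcongr
        refine (setLIntegral_le_lintegral _ _).trans ?_
        rw [lintegral_const_mul _ (by fun_prop), lintegral_add_left (by fun_prop)]
        gcongr
        · exact hexp lam hl rfl
        · exact hexp (-lam) hl' (neg_sq _)
    _ = _ := by
        rw [← ENNReal.ofReal_add (Real.exp_pos _).le (Real.exp_pos _).le, ← ENNReal.ofReal_mul hD0]
        congr 2
        rw [Real.rpow_def_of_pos hn0, ← hLdef, hD, ← two_mul, mul_left_comm, ← Real.exp_add,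
          mul_assoc, ← Real.exp_add]
        congr 2
        ring

/-! ### Probability of a sparse cell. -/

/-- Weighting each sensor of the cell by `1/3` is the exponential tilt suited to a count falling to
a third of its mean `n/k`. -/
theorem lintegral_cell_weight {k j : ℕ} (hj : j < k) :
    ∫⁻ t in Set.Icc (0 : ℝ) 1, (if cellIndex k t = j then ENNReal.ofReal (1 / 3) else 1)
      = ENNReal.ofReal (1 - 2 / (3 * k)) := by
  have hm : Measurable fun t => if cellIndex k t = j then ENNReal.ofReal (1 / 3) else 1 :=
    Measurable.ite (measurableSet_cellIndex_eq k j) measurable_const measurable_const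
  have h : (∫⁻ t in Set.Icc (0 : ℝ) 1, (if cellIndex k t = j then ENNReal.ofReal (1 / 3) else 1))
      + ENNReal.ofReal (2 / (3 * k)) = 1 := by
    have h2 : ∫⁻ t in Set.Icc (0 : ℝ) 1,
        {t | cellIndex k t = j}.indicator (fun _ => ENNReal.ofReal (2 / 3)) t
        = ENNReal.ofReal (2 / (3 * k)) := by
      rw [lintegral_indicator_const (measurableSet_cellIndex_eq k j),
        Measure.restrict_apply (measurableSet_cellIndex_eq k j)]
      change _ * volume (cell k j) = _
      rw [volume_cell hj, ← ENNReal.ofReal_mul (by norm_num)]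
      congr 1
      ring
    rw [← h2, ← lintegral_add_left hm]
    have : ∀ t, ((if cellIndex k t = j then ENNReal.ofReal (1 / 3) else 1)
        + {t | cellIndex k t = j}.indicator (fun _ => ENNReal.ofReal (2 / 3)) t) = 1 := by
      intro t
      by_cases ht : cellIndex k t = j
      · rw [if_pos ht, Set.indicator_of_mem (by exact ht),
          ← ENNReal.ofReal_add (by norm_num) (by norm_num)]
        norm_num
      · rw [if_neg ht, Set.indicator_of_notMem (by exact ht), add_zero]
    rw [lintegral_congr this]
    simp
  rw [ENNReal.ofReal_sub _ (by positivity), ENNReal.ofReal_one]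
  exact ENNReal.eq_sub_of_add_eq ENNReal.ofReal_ne_top h

/-- Bounds the tilt on the rare event below by `exp(-(4/9) n/k)`; against the mean `exp(-(2/3) n/k)`
this leaves the exponent `2/9`. -/
theorem log_three_le : Real.log 3 ≤ 4 / 3 := by
  rw [Real.log_le_iff_le_exp (by norm_num), show (4 / 3 : ℝ) = 1 + 1 / 3 by norm_num, Real.exp_add]
  have h1 := Real.exp_one_gt_d9
  have h2 := Real.add_one_le_exp (1 / 3 : ℝ)
  nlinarith

/-- Chernoff bound for the number of sensors in one cell. -/
theorem unitLaw_card_inCell_lt_le {n k j : ℕ} (hj : j < k) :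
    unitLaw n {x | ((inCell k x Finset.univ j).card : ℝ) < 1 / 3 * ((n : ℝ) / k)}
      ≤ ENNReal.ofReal (Real.exp (-(2 / 9 * ((n : ℝ) / k)))) := by
  have hk : (1 : ℝ) ≤ k := by exact_mod_cast (Nat.zero_le j).trans_lt hj
  set F : (Fin n → ℝ) → ℝ≥0∞ :=
    fun x => ∏ l, if cellIndex k (x l) = j then ENNReal.ofReal (1 / 3) else 1 with hF
  have hm : Measurable fun t => if cellIndex k t = j then ENNReal.ofReal (1 / 3) else 1 :=
    Measurable.ite (measurableSet_cellIndex_eq k j) measurable_const measurable_const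
  have hFm : Measurable F :=
    Finset.measurable_prod _ fun l _ => hm.comp (measurable_pi_apply l)
  have hFint : ∫⁻ x, F x ∂unitLaw n ≤ ENNReal.ofReal (Real.exp (-(2 / 3 * ((n : ℝ) / k)))) := by
    rw [hF, unitLaw, lintegral_pi_prod (fun _ => volume.restrict (Set.Icc (0 : ℝ) 1))
      (fun _ t => if cellIndex k t = j then ENNReal.ofReal (1 / 3) else 1) fun _ => hm]
    rw [lintegral_cell_weight hj, Finset.prod_const, Finset.card_univ, Fintype.card_fin]
    have h0 : 0 ≤ 1 - 2 / (3 * (k : ℝ)) := by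
      rw [sub_nonneg, div_le_one (by positivity)]
      linarith
    rw [← ENNReal.ofReal_pow h0]
    refine ENNReal.ofReal_le_ofReal ?_
    have h1 : 1 - 2 / (3 * (k : ℝ)) ≤ Real.exp (-(2 / (3 * k))) := by
      linarith [Real.add_one_le_exp (-(2 / (3 * (k : ℝ))))]
    refine (pow_le_pow_left₀ h0 h1 n).trans (le_of_eq ?_)
    rw [← Real.exp_nat_mul]
    congr 1
    field_simp
  have hsub : {x : Fin n → ℝ | ((inCell k x Finset.univ j).card : ℝ) < 1 / 3 * ((n : ℝ) / k)}
      ⊆ {x | ENNReal.ofReal (Real.exp (-(4 / 9 * ((n : ℝ) / k)))) ≤ F x} := by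
    intro x hx
    change ((inCell k x Finset.univ j).card : ℝ) < 1 / 3 * ((n : ℝ) / k) at hx
    have hFx : F x = ENNReal.ofReal ((1 / 3) ^ (inCell k x Finset.univ j).card) := by
      rw [hF, ENNReal.ofReal_pow (by norm_num)]
      dsimp only
      rw [← Finset.prod_filter, Finset.prod_const]
      rfl
    change _ ≤ F x
    rw [hFx]
    refine ENNReal.ofReal_le_ofReal ?_
    have h3 : (1 / 3 : ℝ) = Real.exp (-Real.log 3) := by
      rw [Real.exp_neg, Real.exp_log (by norm_num)]
      norm_num
    rw [h3, ← Real.exp_nat_mul, Real.exp_le_exp]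
    have := log_three_le
    have hc : (0 : ℝ) ≤ (inCell k x Finset.univ j).card := by positivity
    nlinarith
  set e := ENNReal.ofReal (Real.exp (-(4 / 9 * ((n : ℝ) / k)))) with he
  have he0 : e ≠ 0 := by
    rw [he, Ne, ENNReal.ofReal_eq_zero, not_le]
    exact Real.exp_pos _
  refine (measure_mono hsub).trans ((meas_ge_le_lintegral_div hFm.aemeasurable he0
    ENNReal.ofReal_ne_top).trans ?_)
  rw [ENNReal.div_le_iff he0 ENNReal.ofReal_ne_top, he, ← ENNReal.ofReal_mul (Real.exp_pos _).le,
    ← Real.exp_add]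
  refine hFint.trans (le_of_eq ?_)
  congr 2
  ring

/-- Since `n/k ≥ 9/4 (2 + a) log n`, the factor `2/9` turns each cell's bound into `n^(-1 - a/2)`;
the union over `k ≤ n` cells costs one power of `n`. This explains the value of `p`. -/
theorem unitLaw_sparse_le {a : ℝ} (ha : 0 < a) {n : ℕ} (hn : IsLarge a n) :
    unitLaw n {x | HasSparseCell a x} ≤ ENNReal.ofReal ((n : ℝ) ^ (-(a / 2))) := by
  have hn0 : (0 : ℝ) < n := by exact_mod_cast hn.pos
  have hk0 : (0 : ℝ) < numCells a n := by exact_mod_cast hn.numCells_pos ha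
  have hsub : {x : Fin n → ℝ | HasSparseCell a x} ⊆ ⋃ j ∈ Finset.range (numCells a n),
      {x | ((inCell (numCells a n) x Finset.univ j).card : ℝ)
        < 1 / 3 * ((n : ℝ) / numCells a n)} := by
    rintro x ⟨j, hj, hx⟩
    exact Set.mem_biUnion (Finset.mem_coe.2 (Finset.mem_range.2 hj)) hx
  calc unitLaw n {x | HasSparseCell a x}
      ≤ ∑ j ∈ Finset.range (numCells a n), unitLaw n {x : Fin n → ℝ |
          ((inCell (numCells a n) x Finset.univ j).card : ℝ)
            < 1 / 3 * ((n : ℝ) / numCells a n)} :=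
        (measure_mono hsub).trans (measure_biUnion_finset_le _ _)
    _ ≤ ∑ j ∈ Finset.range (numCells a n), ENNReal.ofReal ((n : ℝ) ^ (-1 - a / 2)) := by
        refine Finset.sum_le_sum fun j hj => ?_
        refine (unitLaw_card_inCell_lt_le (Finset.mem_range.1 hj)).trans
          (ENNReal.ofReal_le_ofReal ?_)
        rw [Real.rpow_def_of_pos hn0, Real.exp_le_exp]
        have h1 := hn.numCells_mul_le ha
        rw [mul_comm, ← le_div_iff₀ hk0] at h1
        linarith
    _ = ENNReal.ofReal (numCells a n * (n : ℝ) ^ (-1 - a / 2)) := by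
        rw [Finset.sum_const, Finset.card_range, nsmul_eq_mul,
          ENNReal.ofReal_mul (by positivity), ENNReal.ofReal_natCast]
    _ ≤ _ := by
        refine ENNReal.ofReal_le_ofReal ?_
        calc (numCells a n : ℝ) * (n : ℝ) ^ (-1 - a / 2)
            ≤ (n : ℝ) ^ (1 : ℝ) * (n : ℝ) ^ (-1 - a / 2) := by
              rw [Real.rpow_one]
              gcongr
              exact_mod_cast hn.numCells_le ha
          _ = _ := by
              rw [← Real.rpow_add hn0]
              congr 1
              ring

/-! ### Measurability of the costs. -/

/-- The infimum runs over an uncountable family, but of continuous functions of `x`, so it is upper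
semicontinuous. -/
theorem measurable_minMovement {n : ℕ} {a : ℝ} (ha : 0 < a) (r : ℝ) :
    Measurable fun x : Fin n → ℝ => minMovement a r x := by
  refine UpperSemicontinuous.measurable (upperSemicontinuous_biInf fun y _ => ?_)
  refine Continuous.upperSemicontinuous ?_
  unfold movement
  refine continuous_finsetSum _ fun i _ => ENNReal.continuous_ofReal.comp ?_
  exact (by fun_prop : Continuous fun x : Fin n → ℝ => |x i - y i|).rpow_const
    fun _ => Or.inr ha.le

theorem measurable_movement_moveChosen {n : ℕ} (a : ℝ) (k m : ℕ) (T : Finset (Fin n)) :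
    Measurable fun x : Fin n → ℝ => movement a x (moveChosen k m x T) :=
  Finset.measurable_sum _ fun i _ => measurable_abs_displacement a k m T i

theorem measurableSet_sparse (a : ℝ) (n : ℕ) :
    MeasurableSet {x : Fin n → ℝ | HasSparseCell a x} := by
  have : {x : Fin n → ℝ | HasSparseCell a x} = ⋃ j ∈ Finset.range (numCells a n),
      {x | ((inCell (numCells a n) x Finset.univ j).card : ℝ)
        < 1 / 3 * ((n : ℝ) / numCells a n)} := by
    ext x
    simp [HasSparseCell]
  rw [this]
  refine Finset.measurableSet_biUnion _ fun j _ => measurableSet_lt ?_ measurable_const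
  exact measurable_from_top.comp (measurable_card_inCell _ _ j)

theorem measurableSet_mem_choices (a : ℝ) {n : ℕ} (T : Finset (Fin n)) :
    MeasurableSet {x : Fin n → ℝ | T ∈ choices a x} := by
  have : {x : Fin n → ℝ | T ∈ choices a x} = ⋂ j ∈ Finset.range (numCells a n),
      {x | (inCell (numCells a n) x T j).card = numChosen a n} := by
    ext x
    simp [mem_choices]
  rw [this]
  exact Finset.measurableSet_biInter _ fun j _ =>
    measurable_card_inCell _ _ j (measurableSet_singleton _)

theorem measurable_algorithmMovement (a : ℝ) (n : ℕ) :
    Measurable fun x : Fin n → ℝ => algorithmMovement a x := by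
  classical
  have hcard : Measurable fun x : Fin n → ℝ => ((choices a x).card : ℝ≥0∞) := by
    have : ∀ x : Fin n → ℝ, ((choices a x).card : ℝ≥0∞)
        = ∑ T : Finset (Fin n), if T ∈ choices a x then 1 else 0 := by
      intro x
      simp
    simp only [this]
    exact Finset.measurable_sum _ fun T _ =>
      Measurable.ite (measurableSet_mem_choices a T) measurable_const measurable_const
  have : (fun x : Fin n → ℝ => algorithmMovement a x) = fun x =>
      if HasSparseCell a x then movement a x (moveChosen 1 n x Finset.univ)
      else ∑ T : Finset (Fin n), if T ∈ choices a x then ((choices a x).card : ℝ≥0∞)⁻¹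
        * movement a x (moveChosen (numCells a n) (numChosen a n) x T) else 0 := by
    ext x
    split_ifs with h
    · exact algorithmMovement_of_sparse h
    · rw [algorithmMovement_of_not_sparse h]
      simp
  rw [this]
  refine Measurable.ite (measurableSet_sparse a n) (measurable_movement_moveChosen a _ _ _)
    (Finset.measurable_sum _ fun T _ =>
      Measurable.ite (measurableSet_mem_choices a T) ?_ measurable_const)
  exact hcard.inv.mul (measurable_movement_moveChosen a _ _ _)

/-! ### Summing the costs in the sparse and dense cases. -/

theorem inCell_congr {n k : ℕ} {x x' : Fin n → ℝ}
    (h : ∀ l, cellIndex k (x l) = cellIndex k (x' l)) (T : Finset (Fin n)) (j : ℕ) :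
    inCell k x T j = inCell k x' T j := by
  simp only [inCell, h]

theorem rate_eq {a : ℝ} {n : ℕ} (hn : IsLarge a n) :
    rate a n = n * (Real.log n / n) ^ (a / 2) * (n : ℝ) ^ (-(a / 2)) := by
  have hn0 : (0 : ℝ) < n := by exact_mod_cast hn.pos
  have : 1 / (n : ℝ) ^ (a / 2 - 1) = n * (n : ℝ) ^ (-(a / 2)) := by
    rw [one_div, ← Real.rpow_neg hn0.le, neg_sub, sub_eq_add_neg, Real.rpow_add hn0, Real.rpow_one]
  rw [rate, this]
  ring

theorem sqrt_rpow {a z : ℝ} (hz : 0 ≤ z) : √z ^ a = z ^ (a / 2) := by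
  rw [Real.sqrt_eq_rpow, ← Real.rpow_mul hz]
  congr 1
  ring

theorem setLIntegral_sparse_le {a : ℝ} (ha : 0 < a) {n : ℕ} (hn : IsLarge a n) :
    ∫⁻ x in {x | HasSparseCell a x}, algorithmMovement a x ∂unitLaw n
      ≤ ENNReal.ofReal (((1 + a) ^ a + 2 * Real.exp 1) * rate a n) := by
  have hn0 : (0 : ℝ) < n := by exact_mod_cast hn.pos
  have hL : 2 ≤ Real.log n := hn.two_le_log
  calc _ = ∫⁻ x in {x | HasSparseCell a x},
        ∑ i, ENNReal.ofReal (|x i - moveChosen 1 n x Finset.univ i| ^ a) ∂unitLaw n :=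
        setLIntegral_congr_fun (measurableSet_sparse a n) fun x hx =>
          algorithmMovement_of_sparse hx
    _ ≤ ∑ _i : Fin n, ENNReal.ofReal (((1 + a) * √(Real.log n / n)) ^ a * (n : ℝ) ^ (-(a / 2))
          + 2 * Real.exp 1 * (n : ℝ) ^ (-a)) := by
        rw [lintegral_finsetSum _ fun i _ => measurable_abs_displacement a _ _ _ i]
        refine Finset.sum_le_sum fun i _ => (setLIntegral_equidistant_rpow_le ha hn _ i).trans ?_
        rw [ENNReal.ofReal_add (by positivity) (by positivity),
          ENNReal.ofReal_mul (p := ((1 + a) * √(Real.log n / n)) ^ a) (by positivity)]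
        gcongr
        exact unitLaw_sparse_le ha hn
    _ = ENNReal.ofReal (n * (((1 + a) * √(Real.log n / n)) ^ a * (n : ℝ) ^ (-(a / 2))
          + 2 * Real.exp 1 * (n : ℝ) ^ (-a))) := by
        rw [Finset.sum_const, Finset.card_univ, Fintype.card_fin, nsmul_eq_mul,
          ENNReal.ofReal_mul hn0.le, ENNReal.ofReal_natCast]
    _ ≤ _ := by
        refine ENNReal.ofReal_le_ofReal ?_
        -- The tail error is absorbed into the rate because `log n ≥ 1`.
        have h1 : (n : ℝ) ^ (-a) ≤ (Real.log n / n) ^ (a / 2) * (n : ℝ) ^ (-(a / 2)) := by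
          have : (n : ℝ) ^ (-a) = (1 / (n : ℝ)) ^ (a / 2) * (n : ℝ) ^ (-(a / 2)) := by
            rw [one_div, Real.inv_rpow hn0.le, ← Real.rpow_neg hn0.le, ← Real.rpow_add hn0]
            congr 1
            ring
          rw [this]
          gcongr
          linarith
        rw [rate_eq hn, Real.mul_rpow (by positivity) (by positivity), sqrt_rpow (by positivity)]
        set R := (Real.log n / n) ^ (a / 2) * (n : ℝ) ^ (-(a / 2)) with hR
        calc _ = (1 + a) ^ a * (n * R) + n * (2 * Real.exp 1 * (n : ℝ) ^ (-a)) := by rw [hR]; ring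
          _ ≤ (1 + a) ^ a * (n * R) + n * (2 * Real.exp 1 * R) := by gcongr
          _ = _ := by rw [hR]; ring

theorem chosen_displacement_le {a : ℝ} (ha : 0 < a) {n : ℕ} (hn : IsLarge a n) :
    (√(numChosen a n) / (numCells a n * numChosen a n)) ^ a
      ≤ 6 ^ a * (3 / 4 * (2 + a)) ^ (a / 2)
        * ((Real.log n / n) ^ (a / 2) * (n : ℝ) ^ (-(a / 2))) := by
  have hn0 : (0 : ℝ) < n := by exact_mod_cast hn.pos
  have hL : 2 ≤ Real.log n := hn.two_le_log
  have hk0 : (0 : ℝ) < numCells a n := by exact_mod_cast hn.numCells_pos ha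
  have hm0 : (0 : ℝ) < numChosen a n := by exact_mod_cast hn.numChosen_pos ha
  have h1 : √(numChosen a n) / (numCells a n * numChosen a n)
      ≤ √(3 / 4 * (2 + a) * Real.log n) * (6 / n) := by
    rw [div_eq_mul_inv]
    refine mul_le_mul (Real.sqrt_le_sqrt (hn.numChosen_le ha)) ?_ (by positivity) (by positivity)
    rw [inv_le_comm₀ (by positivity) (by positivity), inv_div, div_le_iff₀ (by norm_num)]
    linarith [hn.le_cells_mul_chosen ha]
  refine (Real.rpow_le_rpow (by positivity) h1 ha.le).trans (le_of_eq ?_)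
  rw [Real.mul_rpow (by positivity) (by positivity), sqrt_rpow (by positivity),
    Real.mul_rpow (by positivity) (by positivity), Real.div_rpow (by norm_num) hn0.le,
    Real.div_rpow (by positivity) hn0.le]
  have : (n : ℝ) ^ a = (n : ℝ) ^ (a / 2) * (n : ℝ) ^ (a / 2) := by
    rw [← Real.rpow_add hn0]
    congr 1
    ring
  rw [this, Real.rpow_neg hn0.le]
  field_simp

/-- Expected movement of the algorithm given the cells of the sensors, none of them sparse. -/
theorem setLIntegral_assigned_le {a : ℝ} (ha : 0 < a) {n : ℕ} {c : Fin n → ℕ}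
    (hc : ∀ l, c l < numCells a n) :
    ∫⁻ x in assigned (numCells a n) c ∩ {x | ¬ HasSparseCell a x}, algorithmMovement a x ∂unitLaw n
      ≤ unitLaw n (assigned (numCells a n) c) * ENNReal.ofReal (n * (2 * a ^ a * Real.exp 2 *
          (√(numChosen a n) / (numCells a n * numChosen a n)) ^ a)) := by
  set k := numCells a n with hk
  set m := numChosen a n with hm
  set B := 2 * a ^ a * Real.exp 2 * (√m / (k * m)) ^ a with hB
  have hB0 : 0 ≤ B := by positivity
  -- A reference point `x₀` guarantees that the set of choices is nonempty, so its cardinality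
  -- cancels in the average.
  rcases (assigned k c ∩ {x | ¬ HasSparseCell a x}).eq_empty_or_nonempty with he | ⟨x₀, hx₀, hs₀⟩
  · rw [he]
    simp
  have hc₀ : ∀ l, cellIndex k (x₀ l) = c l := fun l => hx₀ l trivial
  -- Admissibility of `T` depends only on the cells, so the sum over `T` can be taken outside the
  -- integral.
  have hcong : ∀ x ∈ assigned k c, choices a x = choices a x₀ := by
    intro x hx
    ext T
    have : ∀ j, inCell k x T j = inCell k x₀ T j :=
      inCell_congr (fun l => (show cellIndex k (x l) = c l from hx l trivial).trans (hc₀ l).symm) T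
    simp only [mem_choices, ← hk, this]
  have hne : (choices a x₀).Nonempty := choices_nonempty a x₀ hs₀
  have hmeas : MeasurableSet (assigned k c ∩ {x | ¬ HasSparseCell a x}) :=
    (measurableSet_assigned k c).inter (measurableSet_sparse a n).compl
  calc ∫⁻ x in assigned k c ∩ {x | ¬ HasSparseCell a x}, algorithmMovement a x ∂unitLaw n
      = ∫⁻ x in assigned k c ∩ {x | ¬ HasSparseCell a x}, ∑ T ∈ choices a x₀,
          ((choices a x₀).card : ℝ≥0∞)⁻¹ * movement a x (moveChosen k m x T) ∂unitLaw n := by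
        refine setLIntegral_congr_fun hmeas fun x hx => ?_
        rw [← hcong x hx.1]
        exact algorithmMovement_of_not_sparse hx.2
    _ ≤ ∫⁻ x in assigned k c, ∑ T ∈ choices a x₀,
          ((choices a x₀).card : ℝ≥0∞)⁻¹ * movement a x (moveChosen k m x T) ∂unitLaw n :=
        lintegral_mono_set Set.inter_subset_left
    _ = ∑ T ∈ choices a x₀, ((choices a x₀).card : ℝ≥0∞)⁻¹ * ∑ i,
          ∫⁻ x in assigned k c, ENNReal.ofReal (|x i - moveChosen k m x T i| ^ a) ∂unitLaw n := by
        rw [lintegral_finsetSum _ fun T _ =>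
          (measurable_movement_moveChosen a k m T).const_mul _]
        refine Finset.sum_congr rfl fun T _ => ?_
        rw [lintegral_const_mul _ (measurable_movement_moveChosen a k m T)]
        congr 1
        exact lintegral_finsetSum _ fun i _ => measurable_abs_displacement a k m T i
    _ ≤ ∑ T ∈ choices a x₀, ((choices a x₀).card : ℝ≥0∞)⁻¹ * ∑ _i : Fin n,
          unitLaw n (assigned k c) * ENNReal.ofReal B := by
        refine Finset.sum_le_sum fun T hT => mul_le_mul' le_rfl (Finset.sum_le_sum fun i _ => ?_)
        by_cases hi : i ∈ T
        · refine lintegral_displacement_rpow_le ha hc hi ?_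
          have := mem_choices.1 hT (c i) (hc i)
          rw [← hm, ← hk] at this
          simpa only [inCell, hc₀] using this
        · simp [moveChosen_of_notMem hi, ha.ne']
    _ = _ := by
        rw [Finset.sum_const, Finset.sum_const, Finset.card_univ, Fintype.card_fin, nsmul_eq_mul,
          nsmul_eq_mul, ← mul_assoc, ENNReal.mul_inv_cancel (by simpa using hne.ne_empty)
          (ENNReal.natCast_ne_top _), one_mul,
          ENNReal.ofReal_mul (p := (n : ℝ)) (by positivity), ENNReal.ofReal_natCast]
        ring

theorem setLIntegral_not_sparse_le {a : ℝ} (ha : 0 < a) {n : ℕ} (hn : IsLarge a n) :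
    ∫⁻ x in {x | ¬ HasSparseCell a x}, algorithmMovement a x ∂unitLaw n
      ≤ ENNReal.ofReal
        (2 * a ^ a * Real.exp 2 * (6 ^ a * (3 / 4 * (2 + a)) ^ (a / 2)) * rate a n) := by
  set k := numCells a n with hk
  have hk0 : 0 < k := hn.numCells_pos ha
  set A : (Fin n → Fin k) → Set (Fin n → ℝ) := fun c => assigned k fun l => (c l : ℕ) with hA
  have hAm : ∀ c, MeasurableSet (A c) := fun c => measurableSet_assigned k _
  have hAd : Pairwise (Function.onFun Disjoint A) := by
    intro c c' hcc
    refine Set.disjoint_left.2 fun x hx hx' => hcc ?_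
    ext l
    exact (hx l trivial).symm.trans (hx' l trivial)
  -- `cellIndex` is below `k` on all of `ℝ`, so the cell assignments partition the whole space and
  -- their probabilities sum to `1`.
  have hAu : ⋃ c, A c = Set.univ := by
    refine Set.eq_univ_of_forall fun x => Set.mem_iUnion.2
      ⟨fun l => ⟨cellIndex k (x l), cellIndex_lt hk0 _⟩, fun l _ => rfl⟩
  set N := ENNReal.ofReal (n * (2 * a ^ a * Real.exp 2 *
    (√(numChosen a n) / (k * numChosen a n)) ^ a)) with hN
  have hS : MeasurableSet {x : Fin n → ℝ | ¬ HasSparseCell a x} := (measurableSet_sparse a n).compl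
  calc _ = ∑' c, ∫⁻ x in A c ∩ {x | ¬ HasSparseCell a x}, algorithmMovement a x ∂unitLaw n := by
        rw [← lintegral_iUnion (fun c => (hAm c).inter hS)
          (fun c c' h => (hAd h).mono Set.inter_subset_left Set.inter_subset_left),
          ← Set.iUnion_inter, hAu, Set.univ_inter]
    _ ≤ ∑' c, unitLaw n (A c) * N :=
        ENNReal.tsum_le_tsum fun c => setLIntegral_assigned_le ha fun l => (c l).isLt
    _ = N := by
        rw [ENNReal.tsum_mul_right, ← measure_iUnion hAd hAm, hAu, measure_univ, one_mul]
    _ ≤ _ := by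
        refine ENNReal.ofReal_le_ofReal ?_
        rw [rate_eq hn]
        calc _ ≤ n * (2 * a ^ a * Real.exp 2 * (6 ^ a * (3 / 4 * (2 + a)) ^ (a / 2)
              * ((Real.log n / n) ^ (a / 2) * (n : ℝ) ^ (-(a / 2))))) := by
              gcongr
              exact chosen_displacement_le ha hn
          _ = _ := by ring

/-- The constant in the bound on the expected movement of the algorithm. -/
def movementConst (a : ℝ) : ℝ :=
  (1 + a) ^ a + 2 * Real.exp 1
    + 2 * a ^ a * Real.exp 2 * (6 ^ a * (3 / 4 * (2 + a)) ^ (a / 2))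

theorem movementConst_pos {a : ℝ} (ha : 0 < a) : 0 < movementConst a := by
  unfold movementConst
  positivity

theorem lintegral_algorithmMovement_le {a : ℝ} (ha : 0 < a) {n : ℕ} (hn : IsLarge a n) :
    ∫⁻ x, algorithmMovement a x ∂unitLaw n ≤ ENNReal.ofReal (movementConst a * rate a n) := by
  have hr : 0 ≤ rate a n := by
    have := hn.two_le_log
    unfold rate
    positivity
  rw [← lintegral_add_compl _ (measurableSet_sparse a n), movementConst, add_mul,
    ENNReal.ofReal_add (by positivity) (by positivity)]
  exact add_le_add (setLIntegral_sparse_le ha hn) (setLIntegral_not_sparse_le ha hn)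

theorem map_eq_unitLaw {n : ℕ} {Ω : Type*} [MeasurableSpace Ω] {P : Measure Ω}
    [IsProbabilityMeasure P] {X : Fin n → Ω → ℝ} (hX : ∀ i, Measurable (X i))
    (hind : iIndepFun X P) (hu : ∀ i, pdf.IsUniform (X i) (Set.Icc (0 : ℝ) 1) P volume) :
    P.map (fun ω i => X i ω) = unitLaw n := by
  rw [(iIndepFun_iff_map_fun_eq_pi_map fun i => (hX i).aemeasurable).1 hind, unitLaw]
  congr 1
  ext1 i
  rw [hu i]
  simp [ProbabilityTheory.cond]

end SensorCover

end

theorem mainTheorem5 (a : ℝ) (ha : 0 < a) :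
    (∃! x₀ : ℝ, SensorCover.IsThreshold a x₀) ∧
    ∀ x₀ : ℝ, SensorCover.IsThreshold a x₀ →
      ∃ C : ℝ, 0 < C ∧ ∀ (f : ℝ) (n : ℕ), 6 < f → ⌈x₀⌉₊ ≤ n →
        -- the algorithm always ends in a placement in `[0,1]` that covers `[0,1]`
        (∀ x : Fin n → ℝ, (∀ i, x i ∈ Set.Icc (0 : ℝ) 1) →
          ∀ y ∈ (SensorCover.algorithm a x).support,
            SensorCover.Covers (f / (2 * n)) y ∧ ∀ i, y i ∈ Set.Icc (0 : ℝ) 1) ∧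
        ∀ {Ω : Type*} [MeasurableSpace Ω] (P : Measure Ω) [IsProbabilityMeasure P]
          (X : Fin n → Ω → ℝ), (∀ i, Measurable (X i)) → iIndepFun X P →
          (∀ i, pdf.IsUniform (X i) (Set.Icc (0 : ℝ) 1) P volume) →
          -- the expected required movement
          (AEMeasurable (fun ω => SensorCover.minMovement a (f / (2 * n)) fun i => X i ω) P ∧
            ∫⁻ ω, SensorCover.minMovement a (f / (2 * n)) (fun i => X i ω) ∂P
              ≤ ENNReal.ofReal (C * SensorCover.rate a n)) ∧
          -- the expected movement of the algorithm
          (AEMeasurable (fun ω => SensorCover.algorithmMovement a fun i => X i ω) P ∧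
            ∫⁻ ω, SensorCover.algorithmMovement a (fun i => X i ω) ∂P
              ≤ ENNReal.ofReal (C * SensorCover.rate a n)) := by
  refine ⟨SensorCover.existsUnique_isThreshold ha, fun x₀ hx₀ =>
    ⟨SensorCover.movementConst a, SensorCover.movementConst_pos ha, fun f n hf hn => ?_⟩⟩
  have hlarge := SensorCover.isLarge_of_threshold ha hx₀ hn
  refine ⟨fun x hx y hy => SensorCover.algorithm_valid ha hf hlarge hx hy, ?_⟩
  intro Ω _ P _ X hX hind hu
  have hmap := SensorCover.map_eq_unitLaw hX hind hu
  have hXm : Measurable fun ω i => X i ω := measurable_pi_lambda _ hX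
  have hmin := SensorCover.measurable_minMovement (n := n) ha (f / (2 * n))
  have halg := SensorCover.measurable_algorithmMovement a n
  refine ⟨⟨(hmin.comp hXm).aemeasurable, ?_⟩, (halg.comp hXm).aemeasurable, ?_⟩
  · rw [← lintegral_map hmin hXm, hmap]
    refine (lintegral_mono_ae ((SensorCover.ae_mem_unit n).mono fun x hx => ?_)).trans
      (SensorCover.lintegral_algorithmMovement_le ha hlarge)
    exact SensorCover.minMovement_le_algorithmMovement ha hf hlarge hx
  · rw [← lintegral_map halg hXm, hmap]
    exact SensorCover.lintegral_algorithmMovement_le ha hlarge
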